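/- **Setting.** Let $\mathscr{P}$ be the set of all partitions of non-negative integers. For $\lambda\in\mathscr{P}$ let $|\lambda|$ be its size and $r_m(\lambda)$ the number of parts of $\lambda$ equal to $m$. For $f:\mathscr{P}\to\mathbb{Q}$ the $q$-bracket is $$\langle f\rangle_q=\frac{\sum_{\lambda} f(\lambda)q^{|\lambda|}}{\sum_{\lambda} q^{|\lambda|}}\in\mathbb{Q}[[q]].$$ Let $\Psi:\bigoplus_{n\ge 0}\mathbb{Q}[x_1,\dots,x_n,y_1,\dots,y_n]\to\mathbb{Q}^{\mathscr{P}}$ be the linear map that sends a polynomial $p$ in the $n$-th summand to $$\lambda\mapsto\sum_{m_1>\dots>m_n>0}\ \sum_{r_1=1}^{r_{m_1}(\lambda)}\cdots\sum_{r_n=1}^{r_{m_n}(\lambda)}p(m_1,\dots,m_n,r_1,\dots,r_n).$$ Let $\mathbb{P}=\operatorname{Im}\Psi$ be the space of polynomial functions on partitions. A function $f\in\mathbb{P}$ is of weight $\le k$ if $f=\Psi\bigl((g_n)_{n}\bigr)$ with $\deg g_n+n\le k$ for all $n$ with $g_n\neq 0$. Let $\widetilde M=\mathbb{Q}[G_k\mid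 k\ge 2\text{ even}]\subset\mathbb{Q}[[q]]$ be the ring of quasimodular forms, where $G_k=-\frac{B_k}{2\,k!}+\frac{1}{(k-1)!}\sum_{m,r\ge1}m^{k-1}q^{mr}$, and let $\mathbb{M}=\{f\in\mathbb{P}\mid\langle f\rangle_q\in\widetilde M\}$. For $g\in\mathbb{Q}[x,y]$ the arm-leg moment function is $$\mathcal{A}_g(\lambda)=\sum_{\xi\in Y_\lambda}g\bigl(a(\xi)+\tfrac12,\;b(\xi)+\tfrac12\bigr),$$ the sum being over the cells $\xi$ of the Young diagram of $\lambda$ (whose rows have lengths $\lambda_1\ge\lambda_2\ge\cdots$), with $a(\xi)$ and $b(\xi)$ the arm length (along the row) and leg length (along the column) of $\xi$. Let $\mathcal{F}=(f_k)_{k\ge 0}$ be a well-normalized sequence of polynomials in $\mathbb{Q}[x]$, i.e. $f_k$ has degree $k$ and leading coefficient $1/k!$, and $f_k(0)=0$ for $k\ge1$. For $k_1,\dots,k_n\ge1$ and $d_1,\dots,d_n\ge0$ put $$\exp P_{\mathcal F}(k_1,\dots,k_n;d_1,\dots,d_n)(\lambda)=\sum_{m_1\ge\dots\ge m_n>0}\frac{1}{\operatorname{Aut}(m)}\prod_{j=1}^n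 m_j^{d_j}f_{k_j}(r_{m_j}(\lambda)),\qquad \operatorname{Aut}(m)=\prod_{j}\#\{i\mid m_i=j\}!\,.$$ **Theorem (Zagier's arm-leg moments).** 1. For every $g\in\mathbb{Q}[x,y]$, the function $\mathcal{A}_g$ lies in $\mathbb{P}$ and is of weight $\le\deg g+2$ (where $\deg$ is the total degree). 2. If $g$ is even, i.e. $g(-x,-y)=g(x,y)$, then $\mathcal{A}_g\in\mathbb{M}$, i.e. its $q$-bracket is also quasimodular. 3. For all integers $a,b\ge0$ and $g=\frac{x^ay^b}{a!\,b!}$, the function $$\mathcal{A}_g-\sum_{i=0}^a\frac{(-1)^{a-i}}{i!\,(a+1-i)!}\,\exp P_{\mathcal F}\bigl(\underbrace{1,\dots,1}_{b+1};\,i,\underbrace{0,\dots,0}_{b-1},a-i+1\bigr)$$ lies in $\mathbb{P}$ and is of weight $\le\deg g+1=a+b+1$. Here, for $b=0$, the vector $(i,0,\dots,0,a-i+1)$ of length $b+1=1$ is read as $(a+1)$ (the first and last entries coincide and their exponents add up). -/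

import Mathlib

open scoped Nat PowerSeries DirectSum

namespace ArmLeg

/-- Partitions of all non-negative integers; `lam.1` is the size of `lam`. -/
abbrev Ptn : Type := Σ n : ℕ, Nat.Partition n

/-- `mult m lam` is the number of times `m` occurs as a part of `lam`. -/
def mult (m : ℕ) (lam : Ptn) : ℕ := lam.2.parts.count m

/-- A number larger than the size of `lam` is not a part of `lam`, so that sums over parts
may be restricted to the numbers `1, …, lam.1`. -/
lemma mult_eq_zero {m : ℕ} {lam : Ptn} (h : lam.1 < m) : mult m lam = 0 :=
  Multiset.count_eq_zero.2 fun hm => absurd (Nat.Partition.le_of_mem_parts hm) (not_le.2 h)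

/-- The Young diagram of a partition: row `i` (counted from `0`) has length equal to the
`(i + 1)`-st largest part. -/
def young (lam : Ptn) : YoungDiagram :=
  YoungDiagram.ofRowLens (lam.2.parts.sort (· ≥ ·)) (lam.2.parts.pairwise_sort (· ≥ ·)).sortedGE

/-- The arm length of the cell `c = (row, column)` (counted from `0`): the number of cells
of the diagram to the right of `c` in the same row. -/
def arm (D : YoungDiagram) (c : ℕ × ℕ) : ℕ := D.rowLen c.1 - (c.2 + 1)

/-- The leg length of the cell `c = (row, column)` (counted from `0`): the number of cells
of the diagram below `c` in the same column. -/
def leg (D : YoungDiagram) (c : ℕ × ℕ) : ℕ := D.colLen c.2 - (c.1 + 1)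

/-- The arm-leg moment function of `g`; `X 0` and `X 1` are the variables `x` and `y`. -/
noncomputable def armLegMoment (g : MvPolynomial (Fin 2) ℚ) (lam : Ptn) : ℚ :=
  ∑ c ∈ (young lam).cells,
    MvPolynomial.eval ![(arm (young lam) c : ℚ) + 1 / 2, (leg (young lam) c : ℚ) + 1 / 2] g

/-- The tuples `m₁ > ⋯ > m_n > 0` with entries at most `N`. -/
def strictTuples (n N : ℕ) : Finset (Fin n → ℕ) :=
  {m ∈ Fintype.piFinset fun _ : Fin n => Finset.Icc 1 N | ∀ i j, i < j → m j < m i}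

/-- The tuples `m₁ ≥ ⋯ ≥ m_n > 0` with entries at most `N`. -/
def weakTuples (n N : ℕ) : Finset (Fin n → ℕ) :=
  {m ∈ Fintype.piFinset fun _ : Fin n => Finset.Icc 1 N | ∀ i j, i ≤ j → m j ≤ m i}

/-- Polynomials in `x₁, …, x_n` (the variables `Sum.inl i`) and `y₁, …, y_n`
(the variables `Sum.inr i`). -/
abbrev PolyXY (n : ℕ) : Type := MvPolynomial (Fin n ⊕ Fin n) ℚ

/-- The component of `Psi` on polynomials in `x₁, …, x_n, y₁, …, y_n`:
`lam ↦ ∑_{m₁ > ⋯ > m_n > 0} ∑_{r₁ = 1}^{mult m₁ lam} ⋯ ∑_{r_n = 1}^{mult m_n lam} p(m, r)`.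
If some `m_i` exceeds the size of `lam`, then the corresponding inner sum is empty. -/
noncomputable def psiComponent (n : ℕ) : PolyXY n →ₗ[ℚ] (Ptn → ℚ) where
  toFun p lam :=
    ∑ m ∈ strictTuples n lam.1,
      ∑ r ∈ Fintype.piFinset fun i : Fin n => Finset.Icc 1 (mult (m i) lam),
        MvPolynomial.eval (Sum.elim (fun i => (m i : ℚ)) (fun i => (r i : ℚ))) p
  map_add' p q := by
    funext lam
    simp [Finset.sum_add_distrib]
  map_smul' c p := by
    funext lam
    simp [Finset.mul_sum]

/-- The map `Ψ : ⨁ₙ ℚ[x₁, …, x_n, y₁, …, y_n] → ℚ^𝒫`. -/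
noncomputable def Psi : (⨁ n : ℕ, PolyXY n) →ₗ[ℚ] (Ptn → ℚ) :=
  DirectSum.toModule ℚ ℕ (Ptn → ℚ) psiComponent

/-- The space `ℙ` of polynomial functions on partitions. -/
noncomputable def polynomialFunctions : Submodule ℚ (Ptn → ℚ) := LinearMap.range Psi

/-- `f` is a polynomial function on partitions of weight `≤ k`: it is `Ψ(g)` with
`deg gₙ + n ≤ k` for every non-zero component `gₙ` of `g`. (As the `u`-bracket is injective,
`f = Ψ(g)` says the same as `⟨f⟩_u = ⟨Ψ(g)⟩_u = Φ(g)`.) -/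
def HasWeightLE (f : Ptn → ℚ) (k : ℕ) : Prop :=
  ∃ g : ⨁ n : ℕ, PolyXY n, (∀ n, g n ≠ 0 → (g n).totalDegree + n ≤ k) ∧ Psi g = f

/-- The `q`-bracket `(∑_lam f(lam) q^|lam|) / (∑_lam q^|lam|)`. -/
noncomputable def qBracket (f : Ptn → ℚ) : ℚ⟦X⟧ :=
  PowerSeries.mk (fun n => ∑ p : Nat.Partition n, f ⟨n, p⟩) *
    (PowerSeries.mk fun n => (Fintype.card (Nat.Partition n) : ℚ))⁻¹

/-- The Eisenstein series
`G_k = -B_k / (2 k!) + 1 / (k - 1)! * ∑_{m, r ≥ 1} m^(k-1) q^(m r)`, as a `q`-series. -/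
noncomputable def eisenstein (k : ℕ) : ℚ⟦X⟧ :=
  PowerSeries.C (-(bernoulli k) / (2 * (k ! : ℚ))) +
    PowerSeries.mk fun n =>
      1 / ((k - 1)! : ℚ) * ∑ mr ∈ n.divisorsAntidiagonal, (mr.1 : ℚ) ^ (k - 1)

/-- The algebra `ℚ[G₂, G₄, G₆, …]` of quasimodular forms. -/
noncomputable def quasimodularForms : Subalgebra ℚ ℚ⟦X⟧ :=
  Algebra.adjoin ℚ {G | ∃ k : ℕ, 2 ≤ k ∧ Even k ∧ G = eisenstein k}

/-- The space `𝕄` of polynomial functions on partitions with quasimodular `q`-bracket. -/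
def quasimodularFunctions : Set (Ptn → ℚ) :=
  {f | f ∈ polynomialFunctions ∧ qBracket f ∈ quasimodularForms}

/-- Well-normalized polynomial sequences: `f_k` has degree `k` and leading coefficient
`1 / k!`, and `f_k(0) = 0` for `k ≥ 1`. -/
def IsWellNormalized (F : ℕ → Polynomial ℚ) : Prop :=
  ∀ k, (F k).degree = k ∧ (F k).leadingCoeff = 1 / (k ! : ℚ) ∧ (1 ≤ k → (F k).eval 0 = 0)

/-- `Aut(m) = ∏_j (number of indices i with m_i = j)!`. -/
def aut {n : ℕ} (m : Fin n → ℕ) : ℕ :=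
  ∏ j ∈ Finset.univ.image m, (Finset.card {i | m i = j})!

/-- The function `exp P_F(k₁, …, k_n; d₁, …, d_n)` for `k₁, …, k_n ≥ 1`:
`lam ↦ ∑_{m₁ ≥ ⋯ ≥ m_n > 0} 1 / Aut(m) * ∏ⱼ mⱼ^dⱼ * f_{kⱼ}(mult mⱼ lam)`.
The terms in which some `m_j` exceeds the size of `lam` vanish, since `f_k(0) = 0` for
`k ≥ 1`. -/
noncomputable def expP (F : ℕ → Polynomial ℚ) {n : ℕ} (k d : Fin n → ℕ) (lam : Ptn) : ℚ :=
  ∑ m ∈ weakTuples n lam.1,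
    1 / (aut m : ℚ) * ∏ j, (m j : ℚ) ^ d j * (F (k j)).eval (mult (m j) lam : ℚ)

/-- The exponent vector `(i, 0, …, 0, e)` of length `b + 1`; for `b = 0` it is `(i + e)`. -/
def endVector (b i e : ℕ) : Fin (b + 1) → ℕ :=
  fun j => (if j = 0 then i else 0) + (if j = Fin.last b then e else 0)

end ArmLeg

/-! Index a cell by the length m of its row, its column c (from 1) and its position i among the rows
of length m. Its arm is m - c and its leg is i + S(c, m), where S(c, m) counts the parts in [c, m)
(`sum_arm_leg`). With Bernoulli-type polynomials F_k such that F_k(x+1) - F_k(x) = (x+1/2)^k, the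
moment of x^a y^b becomes D(F_a, F_b), where D is the bilinear expression `doubleDiffSum`.

Weight: a discrete Taylor expansion of H(S(c, m)) in backward differences (`eval_add_sum_eq`)
produces sums over m₁ > ⋯ > m_n ≥ c, and the sum over c ≤ m_n telescopes. Thus D(F, H) is a sum of
`psiComponent`s of (F(x₁) - F(x₁ - x_n)) ∇ⁿH(y₁ + ⋯ + y_n). Each difference lowers the degree by one
while the length grows by one, so the weight is at most deg F + deg H (`hasWeightLE_doubleDiffSum`).

Leading term: by the multinomial and binomial theorems the given combination of exp P functions is
exactly D(x^(a+1)/(a+1)!, x^(b+1)/(b+1)!) (`sum_expP_eq`). Since F_k/k! differs from x^(k+1)/(k+1)!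
in degree at most k, one unit of weight is lost.

Quasimodularity: the generating series of cells with arm A and leg B is q^h/(1 - q^h) times that of
all partitions, with h = A + B + 1 (`partitionSeries_cells`). Hence the bracket of the moment is ∑_n
q^n ∑_{h ∣ n} Q(h), where Q(h) sums the monomial over A + B = h - 1. If a + b is even then Q is an
odd polynomial, so only divisor sums of odd powers, that is Eisenstein series of even weight, occur.
-/

namespace ArmLeg

/-- The number of parts `j` of `lam` with `c ≤ j < m`. -/
def partsBetween (c m : ℕ) (lam : Ptn) : ℕ := ∑ j ∈ Finset.Ico c m, mult j lam

/-! ### Cells of a Young diagram in terms of multiplicities of parts -/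

section Cells

variable {M : Type*} [AddCommMonoid M]

lemma sum_cellsOfRowLens_cons (w : ℕ) (ws : List ℕ) (f : ℕ × ℕ → M) :
    ∑ c ∈ YoungDiagram.cellsOfRowLens (w :: ws), f c =
      ∑ j ∈ Finset.range w, f (0, j) +
        ∑ c ∈ YoungDiagram.cellsOfRowLens ws, f (c.1 + 1, c.2) := by
  rw [YoungDiagram.cellsOfRowLens, Finset.sum_union, Finset.sum_product]
  · simp only [Finset.sum_singleton, Finset.sum_map]
    rfl
  · rw [Finset.disjoint_left]
    rintro ⟨i, j⟩ h1 h2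
    simp only [Finset.mem_product, Finset.mem_singleton] at h1
    simp [h1.1] at h2

lemma rowLen_ofRowLens_cons_zero {w : ℕ} {ws : List ℕ} (h : (w :: ws).SortedGE) :
    (YoungDiagram.ofRowLens (w :: ws) h).rowLen 0 = w :=
  YoungDiagram.rowLen_ofRowLens (w := w :: ws) (hw := h) ⟨0, by simp⟩

lemma rowLen_ofRowLens_cons_succ {w : ℕ} {ws : List ℕ} (h : (w :: ws).SortedGE)
    (h' : ws.SortedGE) (i : ℕ) :
    (YoungDiagram.ofRowLens (w :: ws) h).rowLen (i + 1) =
      (YoungDiagram.ofRowLens ws h').rowLen i := by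
  refine eq_of_forall_lt_iff fun j => ?_
  rw [← YoungDiagram.mem_iff_lt_rowLen, ← YoungDiagram.mem_iff_lt_rowLen,
    YoungDiagram.mem_ofRowLens, YoungDiagram.mem_ofRowLens]
  simp

lemma colLen_ofRowLens_cons {w : ℕ} {ws : List ℕ} (h : (w :: ws).SortedGE)
    (h' : ws.SortedGE) {j : ℕ} (hj : j < w) :
    (YoungDiagram.ofRowLens (w :: ws) h).colLen j =
      (YoungDiagram.ofRowLens ws h').colLen j + 1 := by
  refine eq_of_forall_lt_iff fun i => ?_
  rw [← YoungDiagram.mem_iff_lt_colLen, YoungDiagram.mem_ofRowLens]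
  cases i with
  | zero => simp [hj]
  | succ i =>
    rw [Nat.add_lt_add_iff_right, ← YoungDiagram.mem_iff_lt_colLen, YoungDiagram.mem_ofRowLens]
    simp

lemma colLen_ofRowLens (ws : List ℕ) (h : ws.SortedGE) (j : ℕ) :
    (YoungDiagram.ofRowLens ws h).colLen j = ws.countP (j < ·) := by
  induction ws with
  | nil =>
    refine Nat.eq_zero_of_not_pos fun h0 => ?_
    rw [← YoungDiagram.mem_iff_lt_colLen, YoungDiagram.mem_ofRowLens] at h0
    simp at h0
  | cons w ws ih =>
    have hp := List.pairwise_cons.1 h.pairwise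
    by_cases hj : j < w
    · rw [colLen_ofRowLens_cons h hp.2.sortedGE hj, ih, List.countP_cons_of_pos (by simpa)]
    · have h1 : (w :: ws).countP (j < ·) = 0 := by
        rw [List.countP_eq_zero]
        intro x hx
        rcases List.mem_cons.1 hx with rfl | hx
        · simpa using hj
        · have := hp.1 x hx
          simp
          omega
      rw [h1]
      refine Nat.eq_zero_of_not_pos fun h0 => hj ?_
      rw [← YoungDiagram.mem_iff_lt_colLen, YoungDiagram.mem_ofRowLens] at h0
      simpa using h0

/-- A new first row leaves the old arms and legs alone: every column that meets an old cell grows by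
one, but so does the row index of that cell. -/
lemma sum_arm_leg_cons {w : ℕ} {ws : List ℕ} (h : (w :: ws).SortedGE) (h' : ws.SortedGE)
    (f : ℕ → ℕ → M) :
    ∑ c ∈ (YoungDiagram.ofRowLens (w :: ws) h).cells,
        f (arm (YoungDiagram.ofRowLens (w :: ws) h) c)
          (leg (YoungDiagram.ofRowLens (w :: ws) h) c) =
      ∑ j ∈ Finset.range w, f (w - (j + 1)) (ws.countP (j < ·)) +
        ∑ c ∈ (YoungDiagram.ofRowLens ws h').cells,
          f (arm (YoungDiagram.ofRowLens ws h') c) (leg (YoungDiagram.ofRowLens ws h') c) := by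
  have h1 : (YoungDiagram.ofRowLens (w :: ws) h).cells =
    YoungDiagram.cellsOfRowLens (w :: ws) := rfl
  rw [h1, sum_cellsOfRowLens_cons]
  congr 1
  · refine Finset.sum_congr rfl fun j hj => ?_
    simp only [arm, leg]
    rw [rowLen_ofRowLens_cons_zero, colLen_ofRowLens_cons h h' (Finset.mem_range.1 hj),
      colLen_ofRowLens]
    simp
  · refine Finset.sum_congr rfl fun c hc => ?_
    obtain ⟨hc1, hc2⟩ := YoungDiagram.mem_cellsOfRowLens.1 hc
    have hw : c.2 < w :=
      hc2.trans_le ((List.pairwise_cons.1 h.pairwise).1 _ (List.getElem_mem hc1))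
    simp only [arm, leg]
    rw [rowLen_ofRowLens_cons_succ h h', colLen_ofRowLens_cons h h' hw]
    congr 1
    omega

lemma countP_eq_sum_count {ws : List ℕ} {w j : ℕ} (hw : ∀ x ∈ ws, x ≤ w) :
    ws.countP (j < ·) = ∑ i ∈ Finset.Ico (j + 1) (w + 1), ws.count i := by
  induction ws with
  | nil => simp
  | cons x ws ih =>
    have hx := hw x (by simp)
    rw [List.countP_cons, ih fun y hy => hw y (by simp [hy])]
    simp_rw [List.count_cons, Finset.sum_add_distrib]
    congr 1
    simp only [beq_iff_eq, Finset.sum_ite_eq, Finset.mem_Ico, decide_eq_true_eq]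
    congr 1
    simp only [eq_iff_iff]
    omega

/-- Induction on the rows: putting a longest row w on top only adds the index i = `ws.count w` for m
= w. -/
lemma sum_arm_leg_list (ws : List ℕ) (h : ws.SortedGE) (N : ℕ) (hN : ∀ x ∈ ws, 0 < x ∧ x ≤ N)
    (f : ℕ → ℕ → M) :
    ∑ c ∈ (YoungDiagram.ofRowLens ws h).cells,
        f (arm (YoungDiagram.ofRowLens ws h) c) (leg (YoungDiagram.ofRowLens ws h) c) =
      ∑ m ∈ Finset.Icc 1 N, ∑ c ∈ Finset.Icc 1 m, ∑ i ∈ Finset.range (ws.count m),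
        f (m - c) (i + ∑ j ∈ Finset.Ico c m, ws.count j) := by
  induction ws with
  | nil =>
    have h1 : (YoungDiagram.ofRowLens [] h).cells = ∅ := rfl
    rw [h1]
    simp
  | cons w ws ih =>
    have hp := List.pairwise_cons.1 h.pairwise
    have hw := hN w (by simp)
    rw [sum_arm_leg_cons h hp.2.sortedGE, ih hp.2.sortedGE fun y hy => hN y (by simp [hy])]
    have key : ∀ m ∈ Finset.Icc 1 N,
        ∑ c ∈ Finset.Icc 1 m, ∑ i ∈ Finset.range ((w :: ws).count m),
          f (m - c) (i + ∑ j ∈ Finset.Ico c m, (w :: ws).count j) =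
        (if m = w then ∑ c ∈ Finset.Icc 1 m,
          f (m - c) (ws.count m + ∑ j ∈ Finset.Ico c m, ws.count j) else 0) +
        ∑ c ∈ Finset.Icc 1 m, ∑ i ∈ Finset.range (ws.count m),
          f (m - c) (i + ∑ j ∈ Finset.Ico c m, ws.count j) := by
      intro m _
      -- For m ≤ w the interval [c, m) misses w, so the inner count is unchanged; for m > w there
      -- are no parts m at all.
      by_cases hmw : m ≤ w
      · have h2 : ∀ c, ∑ j ∈ Finset.Ico c m, (w :: ws).count j =
            ∑ j ∈ Finset.Ico c m, ws.count j := fun c =>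
          Finset.sum_congr rfl fun j hj => List.count_cons_of_ne (by
            have := (Finset.mem_Ico.1 hj).2
            omega)
        simp_rw [h2]
        by_cases hm : m = w
        · subst hm
          simp only [List.count_cons_self, Finset.sum_range_succ, if_true]
          rw [Finset.sum_add_distrib, add_comm]
        · rw [List.count_cons_of_ne (Ne.symm hm), if_neg hm, zero_add]
      · have h3 : ws.count m = 0 := List.count_eq_zero.2 fun hm => hmw (hp.1 m hm)
        have h4 : (w :: ws).count m = 0 := by
          rw [List.count_cons_of_ne (by omega), h3]
        rw [h3, h4, if_neg (by omega)]
        simp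
    rw [Finset.sum_congr rfl key, Finset.sum_add_distrib, Finset.sum_ite_eq',
      if_pos (Finset.mem_Icc.2 hw)]
    congr 1
    have h5 := Finset.sum_Ico_add' (fun c => f (w - c) (ws.count w +
      ∑ j ∈ Finset.Ico c w, ws.count j)) 0 w 1
    rw [← Finset.Ico_add_one_right_eq_Icc, ← h5, ← Finset.range_eq_Ico]
    refine Finset.sum_congr rfl fun j hj => ?_
    rw [countP_eq_sum_count hp.1, Finset.sum_Ico_succ_top (by
      have := Finset.mem_range.1 hj
      omega), Nat.add_comm (∑ k ∈ _, _)]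

/-- A sum over the cells of the Young diagram in terms of the multiplicities of the parts. -/
theorem sum_arm_leg (lam : Ptn) (f : ℕ → ℕ → M) :
    ∑ c ∈ (young lam).cells, f (arm (young lam) c) (leg (young lam) c) =
      ∑ m ∈ Finset.Icc 1 lam.1, ∑ c ∈ Finset.Icc 1 m, ∑ i ∈ Finset.range (mult m lam),
        f (m - c) (i + partsBetween c m lam) := by
  have hc : ∀ m, (lam.2.parts.sort (· ≥ ·)).count m = mult m lam := fun m => by
    rw [mult, ← Multiset.coe_count, Multiset.sort_eq]
  rw [young, sum_arm_leg_list _ _ lam.1]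
  · simp_rw [hc]
    rfl
  · intro x hx
    rw [Multiset.mem_sort] at hx
    exact ⟨lam.2.parts_pos hx, Nat.Partition.le_of_mem_parts hx⟩

end Cells

lemma partsBetween_succ {c m : ℕ} (h : c ≤ m) (lam : Ptn) :
    partsBetween c (m + 1) lam = partsBetween c m lam + mult m lam :=
  Finset.sum_Ico_succ_top h _

/-! ### Closure properties of the weight filtration -/

section Weight

lemma HasWeightLE.mono {f : Ptn → ℚ} {k l : ℕ} (h : HasWeightLE f k) (hkl : k ≤ l) :
    HasWeightLE f l := by
  obtain ⟨g, hg, rfl⟩ := h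
  exact ⟨g, fun n hn => (hg n hn).trans hkl, rfl⟩

lemma HasWeightLE.mem {f : Ptn → ℚ} {k : ℕ} (h : HasWeightLE f k) :
    f ∈ polynomialFunctions := by
  obtain ⟨g, -, rfl⟩ := h
  exact ⟨g, rfl⟩

lemma hasWeightLE_zero (k : ℕ) : HasWeightLE 0 k :=
  ⟨0, fun _ hn => absurd rfl hn, map_zero _⟩

lemma HasWeightLE.add {f f' : Ptn → ℚ} {k : ℕ} (h : HasWeightLE f k) (h' : HasWeightLE f' k) :
    HasWeightLE (f + f') k := by
  obtain ⟨g, hg, rfl⟩ := h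
  obtain ⟨g', hg', rfl⟩ := h'
  refine ⟨g + g', fun n hn => ?_, map_add _ _ _⟩
  rw [DirectSum.add_apply] at hn ⊢
  -- The degree bound is known only for non-zero components, so vanishing summands are treated
  -- apart.
  by_cases h0 : g n = 0
  · rw [h0, zero_add] at hn ⊢
    exact hg' n hn
  by_cases h1 : g' n = 0
  · rw [h1, add_zero]
    exact hg n h0
  have h2 := hg n h0
  have h3 := hg' n h1
  have h4 := MvPolynomial.totalDegree_add (g n) (g' n)
  omega

lemma HasWeightLE.smul {f : Ptn → ℚ} {k : ℕ} (h : HasWeightLE f k) (a : ℚ) :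
    HasWeightLE (a • f) k := by
  obtain ⟨g, hg, rfl⟩ := h
  refine ⟨a • g, fun n hn => ?_, map_smul _ _ _⟩
  rw [DirectSum.smul_apply] at hn ⊢
  have h1 : g n ≠ 0 := fun h => hn (by rw [h, smul_zero])
  exact (Nat.add_le_add_right (MvPolynomial.totalDegree_smul_le a (g n)) n).trans (hg n h1)

lemma HasWeightLE.sum {ι : Type*} {s : Finset ι} {f : ι → Ptn → ℚ} {k : ℕ}
    (h : ∀ i ∈ s, HasWeightLE (f i) k) : HasWeightLE (∑ i ∈ s, f i) k :=
  Finset.sum_induction _ (HasWeightLE · k) (fun _ _ => HasWeightLE.add) (hasWeightLE_zero k) h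

lemma hasWeightLE_psiComponent {n k : ℕ} {p : PolyXY n} (h : p.totalDegree + n ≤ k) :
    HasWeightLE (psiComponent n p) k := by
  refine ⟨DirectSum.lof ℚ ℕ PolyXY n p, fun i hi => ?_, DirectSum.toModule_lof _ _ _⟩
  rw [DirectSum.lof_eq_of] at hi ⊢
  by_cases hin : n = i
  · subst hin
    rwa [DirectSum.of_eq_same]
  · exact absurd (DirectSum.of_eq_of_ne _ _ _ (Ne.symm hin)) hi

end Weight

/-! ### Peeling the largest entry off a decreasing tuple -/

section Tuples

variable {M : Type*} [AddCommMonoid M]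

/-- The strictly decreasing `n`-tuples with entries in `[c, N)`. -/
def decreasingTuples (n c N : ℕ) : Finset (Fin n → ℕ) :=
  {m ∈ Fintype.piFinset fun _ : Fin n => Finset.Ico c N | ∀ i j, i < j → m j < m i}

lemma mem_decreasingTuples {n c N : ℕ} {m : Fin n → ℕ} :
    m ∈ decreasingTuples n c N ↔
      (∀ i, c ≤ m i ∧ m i < N) ∧ ∀ i j, i < j → m j < m i := by
  simp [decreasingTuples]

lemma strictTuples_eq (n N : ℕ) : strictTuples n N = decreasingTuples n 1 (N + 1) := by
  rw [strictTuples, decreasingTuples, Finset.Ico_add_one_right_eq_Icc]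

lemma cons_mem_decreasingTuples {n c N a : ℕ} {m : Fin n → ℕ} :
    (Fin.cons a m : Fin (n + 1) → ℕ) ∈ decreasingTuples (n + 1) c N ↔
      a ∈ Finset.Ico c N ∧ m ∈ decreasingTuples n c a := by
  simp only [mem_decreasingTuples, Fin.forall_fin_succ, Fin.cons_zero, Fin.cons_succ,
    Finset.mem_Ico, Fin.succ_lt_succ_iff, Fin.succ_pos, Fin.not_lt_zero,
    true_implies, false_implies, true_and]
  constructor
  · rintro ⟨⟨h1, h2⟩, h3, h4⟩
    exact ⟨h1, fun i => ⟨(h2 i).1, h3 i⟩, h4⟩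
  · rintro ⟨h1, h2, h3⟩
    exact ⟨⟨h1, fun i => ⟨(h2 i).1, (h2 i).2.trans h1.2⟩⟩, fun i => (h2 i).2, h3⟩

lemma sum_decreasingTuples_succ (n c N : ℕ) (f : (Fin (n + 1) → ℕ) → M) :
    ∑ m ∈ decreasingTuples (n + 1) c N, f m =
      ∑ a ∈ Finset.Ico c N, ∑ m ∈ decreasingTuples n c a, f (Fin.cons a m) := by
  rw [Finset.sum_sigma']
  refine Finset.sum_nbij' (fun m => ⟨m 0, Fin.tail m⟩) (fun x => Fin.cons x.1 x.2) ?_ ?_ ?_ ?_ ?_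
  · intro m hm
    rw [← Fin.cons_self_tail m, cons_mem_decreasingTuples] at hm
    simpa using hm
  · intro x hx
    rw [cons_mem_decreasingTuples]
    simpa using hx
  · intro m _
    exact Fin.cons_self_tail m
  · intro x _
    rfl
  · intro m _
    rw [Fin.cons_self_tail]

lemma sum_piFinset_cons {n : ℕ} (s : Fin (n + 1) → Finset ℕ) (f : (Fin (n + 1) → ℕ) → M) :
    ∑ r ∈ Fintype.piFinset s, f r =
      ∑ a ∈ s 0, ∑ r ∈ Fintype.piFinset (fun i => s (Fin.succ i)), f (Fin.cons a r) := by
  rw [Finset.sum_sigma']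
  refine Finset.sum_nbij' (fun m => ⟨m 0, Fin.tail m⟩) (fun x => Fin.cons x.1 x.2) ?_ ?_ ?_ ?_ ?_
  · intro m hm
    rw [Fintype.mem_piFinset] at hm
    simp only [Finset.mem_sigma, Fintype.mem_piFinset]
    exact ⟨hm 0, fun i => hm i.succ⟩
  · intro x hx
    simp only [Finset.mem_sigma, Fintype.mem_piFinset] at hx
    rw [Fintype.mem_piFinset]
    refine Fin.cases ?_ ?_
    · exact hx.1
    · exact hx.2
  · intro m _
    exact Fin.cons_self_tail m
  · intro x _
    rfl
  · intro m _
    rw [Fin.cons_self_tail]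

lemma sum_decreasingTuples_box_succ (n c N : ℕ) (R : ℕ → ℕ)
    (f : (Fin (n + 1) → ℕ) → (Fin (n + 1) → ℕ) → M) :
    ∑ m ∈ decreasingTuples (n + 1) c N,
        ∑ r ∈ Fintype.piFinset fun i => Finset.Icc 1 (R (m i)), f m r =
      ∑ a ∈ Finset.Ico c N, ∑ s ∈ Finset.Icc 1 (R a), ∑ m ∈ decreasingTuples n c a,
        ∑ r ∈ Fintype.piFinset fun i => Finset.Icc 1 (R (m i)),
          f (Fin.cons a m) (Fin.cons s r) := by
  rw [sum_decreasingTuples_succ]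
  refine Finset.sum_congr rfl fun a _ => ?_
  rw [Finset.sum_comm (s := Finset.Icc 1 (R a))]
  refine Finset.sum_congr rfl fun m _ => ?_
  rw [sum_piFinset_cons]
  simp

end Tuples

/-! ### Discrete Taylor expansion -/

section Differences

open Polynomial

/-- The backward difference of a polynomial. -/
noncomputable def backwardDiff (H : ℚ[X]) : ℚ[X] := H - H.comp (X - C 1)

lemma eval_backwardDiff (H : ℚ[X]) (x : ℚ) :
    (backwardDiff H).eval x = H.eval x - H.eval (x - 1) := by
  simp [backwardDiff]

lemma natDegree_backwardDiff {H : ℚ[X]} {d : ℕ} (h : H.natDegree ≤ d + 1) :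
    (backwardDiff H).natDegree ≤ d := by
  by_cases h0 : H.natDegree = 0
  · rw [natDegree_eq_zero] at h0
    obtain ⟨a, rfl⟩ := h0
    simp [backwardDiff]
  · have h1 : H ≠ 0 := fun h => h0 (by simp [h])
    have h2 : (H.comp (X - C 1)).natDegree = H.natDegree := by
      rw [natDegree_comp, natDegree_X_sub_C, mul_one]
    have h3 : (backwardDiff H).degree < H.degree := by
      refine degree_sub_lt_left ?_ h1 ?_
      · have h4 : H.comp (X - C 1) ≠ 0 := fun h => h0 (by rw [← h2, h, natDegree_zero])
        rw [degree_eq_natDegree h1, degree_eq_natDegree h4, h2]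
      · rw [leadingCoeff_comp (by rw [natDegree_X_sub_C]; exact one_ne_zero),
          leadingCoeff_X_sub_C, one_pow, mul_one]
    by_cases h6 : backwardDiff H = 0
    · simp [h6]
    · have := natDegree_lt_natDegree h6 h3
      omega

lemma natDegree_iterate_backwardDiff {H : ℚ[X]} {d : ℕ} (n : ℕ) (h : H.natDegree ≤ d + n) :
    (backwardDiff^[n] H).natDegree ≤ d := by
  induction n generalizing H with
  | zero => exact h
  | succ n ih => exact ih (natDegree_backwardDiff h)

lemma eval_add_natCast_sub (H : ℚ[X]) (x : ℚ) (R : ℕ) :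
    H.eval (x + R) - H.eval x = ∑ r ∈ Finset.Icc 1 R, (backwardDiff H).eval (x + r) := by
  induction R with
  | zero => simp
  | succ R ih =>
    rw [Finset.sum_Icc_succ_top (by omega), ← ih, eval_backwardDiff]
    push_cast
    rw [show x + (R + 1) - 1 = x + R by ring]
    ring

/-- The sum is built up in unit steps, labelled by a part m and a copy s of it, in increasing order
of m. The argument of each difference involves only parts below m, so the formula can be iterated
and yields decreasing tuples. -/
lemma eval_add_sum_sub (H : ℚ[X]) (R : ℕ → ℕ) (c N : ℕ) (y : ℚ) :
    H.eval (y + ∑ j ∈ Finset.Ico c N, (R j : ℚ)) = H.eval y +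
      ∑ m ∈ Finset.Ico c N, ∑ s ∈ Finset.Icc 1 (R m),
        (backwardDiff H).eval (y + s + ∑ j ∈ Finset.Ico c m, (R j : ℚ)) := by
  by_cases h : c ≤ N
  · induction N, h using Nat.le_induction with
    | base => simp
    | succ N hN ih =>
      rw [Finset.sum_Ico_succ_top hN, Finset.sum_Ico_succ_top hN, ← add_assoc, ← add_assoc, ← ih,
        ← sub_eq_iff_eq_add', eval_add_natCast_sub]
      exact Finset.sum_congr rfl fun s _ => by rw [add_right_comm]
  · rw [Finset.Ico_eq_empty_of_le (by omega)]
    simp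

/-- Iterating `eval_add_sum_sub` stops after d steps, because each difference lowers the degree and
a constant is insensitive to the shift. -/
lemma eval_add_sum_eq (R : ℕ → ℕ) (c : ℕ) {d : ℕ} {H : ℚ[X]} (hH : H.natDegree ≤ d) (N : ℕ)
    (y : ℚ) :
    H.eval (y + ∑ j ∈ Finset.Ico c N, (R j : ℚ)) =
      ∑ n ∈ Finset.range (d + 1), ∑ m ∈ decreasingTuples n c N,
        ∑ r ∈ Fintype.piFinset fun i => Finset.Icc 1 (R (m i)),
          (backwardDiff^[n] H).eval (y + ∑ i, (r i : ℚ)) := by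
  have hzero : ∀ (H : ℚ[X]) (N : ℕ) (y : ℚ), ∑ m ∈ decreasingTuples 0 c N,
        ∑ r ∈ Fintype.piFinset fun i => Finset.Icc 1 (R (m i)),
          (backwardDiff^[0] H).eval (y + ∑ i, (r i : ℚ)) = H.eval y := by
    intro H N y
    have h1 : decreasingTuples 0 c N = {default} := by
      ext m
      simp [mem_decreasingTuples, Subsingleton.elim m default]
    simp [h1]
  induction d generalizing H N y with
  | zero =>
    rw [Finset.sum_range_one, hzero]
    rw [eq_C_of_natDegree_le_zero hH]
    simp
  | succ d ih =>
    rw [Finset.sum_range_succ', hzero, eval_add_sum_sub, add_comm]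
    congr 1
    simp_rw [sum_decreasingTuples_box_succ]
    rw [Finset.sum_comm]
    refine Finset.sum_congr rfl fun m _ => ?_
    rw [Finset.sum_comm]
    refine Finset.sum_congr rfl fun s _ => ?_
    rw [ih (natDegree_backwardDiff hH)]
    · simp only [Fin.sum_univ_succ, Fin.cons_zero, Fin.cons_succ, Function.iterate_succ_apply,
        add_assoc]

end Differences

/-! ### The bilinear expression and its weight -/

section

open Polynomial

/-- The function `lam ↦ ∑_{m ≥ c ≥ 1} (F(m - c + 1) - F(m - c)) (H(S(c, m + 1)) - H(S(c, m)))`,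
where `S(c, m)` is the number of parts `j` of `lam` with `c ≤ j < m`. -/
noncomputable def doubleDiffSum (F H : ℚ[X]) (lam : Ptn) : ℚ :=
  ∑ m ∈ Finset.Icc 1 lam.1, ∑ c ∈ Finset.Icc 1 m,
    (F.eval ((m : ℚ) - c + 1) - F.eval ((m : ℚ) - c)) *
      (H.eval (partsBetween c (m + 1) lam : ℚ) - H.eval (partsBetween c m lam : ℚ))

lemma doubleDiffSum_sub_left (F F' H : ℚ[X]) :
    doubleDiffSum (F - F') H = doubleDiffSum F H - doubleDiffSum F' H := by
  funext lam
  simp only [doubleDiffSum, Pi.sub_apply, eval_sub, ← Finset.sum_sub_distrib]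
  exact Finset.sum_congr rfl fun _ _ => Finset.sum_congr rfl fun _ _ => by ring

lemma doubleDiffSum_sub_right (F H H' : ℚ[X]) :
    doubleDiffSum F (H - H') = doubleDiffSum F H - doubleDiffSum F H' := by
  funext lam
  simp only [doubleDiffSum, Pi.sub_apply, eval_sub, ← Finset.sum_sub_distrib]
  exact Finset.sum_congr rfl fun _ _ => Finset.sum_congr rfl fun _ _ => by ring

lemma doubleDiffSum_C_mul_left (a : ℚ) (F H : ℚ[X]) :
    doubleDiffSum (C a * F) H = a • doubleDiffSum F H := by
  funext lam
  simp only [doubleDiffSum, Pi.smul_apply, smul_eq_mul, eval_mul, eval_C, Finset.mul_sum]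
  exact Finset.sum_congr rfl fun _ _ => Finset.sum_congr rfl fun _ _ => by ring

lemma doubleDiffSum_C_mul_right (a : ℚ) (F H : ℚ[X]) :
    doubleDiffSum F (C a * H) = a • doubleDiffSum F H := by
  funext lam
  simp only [doubleDiffSum, Pi.smul_apply, smul_eq_mul, eval_mul, eval_C, Finset.mul_sum]
  exact Finset.sum_congr rfl fun _ _ => Finset.sum_congr rfl fun _ _ => by ring

lemma totalDegree_aeval_le {σ : Type*} (F : ℚ[X]) {L : MvPolynomial σ ℚ}
    (hL : L.totalDegree ≤ 1) : (aeval L F).totalDegree ≤ F.natDegree := by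
  rw [aeval_eq_sum_range]
  refine MvPolynomial.totalDegree_finsetSum_le fun i hi => ?_
  refine (MvPolynomial.totalDegree_smul_le _ _).trans ((MvPolynomial.totalDegree_pow _ _).trans ?_)
  have := Finset.mem_range_succ_iff.1 hi
  nlinarith

/-- The polynomial `(F(x₁) - F(x₁ - x_n)) H(y₁ + ⋯ + y_n)`, where `n` is written `n + 1`. -/
noncomputable def endpointPoly (n : ℕ) (F H : ℚ[X]) : PolyXY (n + 1) :=
  (aeval (MvPolynomial.X (Sum.inl 0) : PolyXY (n + 1)) F -
    aeval (MvPolynomial.X (Sum.inl 0) - MvPolynomial.X (Sum.inl (Fin.last n)) :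
      PolyXY (n + 1)) F) *
  aeval (∑ i, MvPolynomial.X (Sum.inr i) : PolyXY (n + 1)) H

lemma totalDegree_endpointPoly (n : ℕ) (F H : ℚ[X]) :
    (endpointPoly n F H).totalDegree ≤ F.natDegree + H.natDegree := by
  refine (MvPolynomial.totalDegree_mul _ _).trans (Nat.add_le_add ?_ ?_)
  · refine (MvPolynomial.totalDegree_sub _ _).trans (max_le ?_ ?_)
    · exact totalDegree_aeval_le F (MvPolynomial.totalDegree_X _).le
    · refine totalDegree_aeval_le F ((MvPolynomial.totalDegree_sub _ _).trans ?_)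
      simp
  · refine totalDegree_aeval_le H (MvPolynomial.totalDegree_finsetSum_le fun i _ => ?_)
    simp

lemma eval_endpointPoly (n : ℕ) (F H : ℚ[X]) (x y : Fin (n + 1) → ℚ) :
    MvPolynomial.eval (Sum.elim x y) (endpointPoly n F H) =
      (F.eval (x 0) - F.eval (x 0 - x (Fin.last n))) * H.eval (∑ i, y i) := by
  have h : ∀ (L : PolyXY (n + 1)) (G : ℚ[X]), MvPolynomial.eval (Sum.elim x y) (aeval L G) =
      G.eval (MvPolynomial.eval (Sum.elim x y) L) := by
    intro L G
    rw [aeval_def, hom_eval₂, eval, eval₂_congr (RingHom.ext_rat _ _) rfl rfl]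
  rw [endpointPoly, map_mul, map_sub, h, h, h]
  simp

/-- Source of the factor F(x₁) - F(x₁ - x_n): the columns c compatible with a tuple are those up to
its smallest entry. -/
lemma sum_Icc_sub_telescope (F : ℚ[X]) (x : ℚ) (N : ℕ) :
    ∑ c ∈ Finset.Icc 1 N, (F.eval (x - c + 1) - F.eval (x - c)) = F.eval x - F.eval (x - N) := by
  induction N with
  | zero => simp
  | succ N ih =>
    rw [Finset.sum_Icc_succ_top (by omega), ih]
    push_cast
    rw [show x - (N + 1) + 1 = x - N by ring]
    ring

lemma le_cons_last_iff {n c a : ℕ} {m : Fin n → ℕ} (hm : m ∈ decreasingTuples n 1 a) :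
    c ≤ (Fin.cons a m : Fin (n + 1) → ℕ) (Fin.last n) ↔ c ≤ a ∧ ∀ i, c ≤ m i := by
  rw [mem_decreasingTuples] at hm
  cases n with
  | zero => simp [Fin.last]
  | succ n =>
    rw [← Fin.succ_last, Fin.cons_succ]
    constructor
    · intro h
      refine ⟨h.trans (hm.1 _).2.le, fun i => h.trans ?_⟩
      rcases (Fin.le_last i).eq_or_lt with rfl | hi
      · exact le_rfl
      · exact (hm.2 _ _ hi).le
    · exact fun h => h.2 _

/-- The difference of H across the parts equal to m supplies the first pair (m, s); the expansion of
∇H at s + S(c, m) supplies the smaller pairs. Hence tuples of length n + 1 and no term of length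
zero. -/
theorem doubleDiffSum_eq_sum_psiComponent (F : ℚ[X]) {H : ℚ[X]} {d : ℕ}
    (hH : H.natDegree ≤ d + 1) :
    doubleDiffSum F H = ∑ n ∈ Finset.range (d + 1),
      psiComponent (n + 1) (endpointPoly n F (backwardDiff^[n + 1] H)) := by
  funext lam
  rw [Finset.sum_apply]
  simp only [psiComponent, LinearMap.coe_mk, AddHom.coe_mk, strictTuples_eq, eval_endpointPoly]
  have h1 : ∀ n ∈ Finset.range (d + 1),
      ∑ m ∈ decreasingTuples (n + 1) 1 (lam.1 + 1),
        ∑ r ∈ Fintype.piFinset fun i => Finset.Icc 1 (mult (m i) lam),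
          (F.eval (m 0 : ℚ) - F.eval ((m 0 : ℚ) - (m (Fin.last n) : ℚ))) *
            (backwardDiff^[n + 1] H).eval (∑ i, (r i : ℚ)) =
      ∑ a ∈ Finset.Icc 1 lam.1, ∑ c ∈ Finset.Icc 1 a,
        (F.eval ((a : ℚ) - c + 1) - F.eval ((a : ℚ) - c)) *
          ∑ s ∈ Finset.Icc 1 (mult a lam), ∑ m ∈ decreasingTuples n c a,
            ∑ r ∈ Fintype.piFinset fun i => Finset.Icc 1 (mult (m i) lam),
              (backwardDiff^[n] (backwardDiff H)).eval (s + ∑ i, (r i : ℚ)) := by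
    intro n _
    rw [sum_decreasingTuples_box_succ n 1 (lam.1 + 1) (fun j => mult j lam)
      (fun m r => (F.eval (m 0 : ℚ) - F.eval ((m 0 : ℚ) - (m (Fin.last n) : ℚ))) *
            (backwardDiff^[n + 1] H).eval (∑ i, (r i : ℚ))), Finset.Ico_add_one_right_eq_Icc]
    refine Finset.sum_congr rfl fun a _ => ?_
    simp_rw [Finset.mul_sum]
    rw [Finset.sum_comm (s := Finset.Icc 1 a)]
    refine Finset.sum_congr rfl fun s _ => ?_
    simp_rw [← sum_Icc_sub_telescope, Fin.cons_zero, Fin.sum_univ_succ, Fin.cons_zero,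
      Fin.cons_succ, Finset.sum_mul]
    -- Exchanging the sums over tuples and c: the condition that c is at most the last entry says
    -- that all entries are at least c.
    rw [Finset.sum_congr rfl fun m _ => Finset.sum_comm,
      Finset.sum_comm' (s' := fun c => decreasingTuples n c a) (t' := Finset.Icc 1 a)]
    · rfl
    · intro m c
      constructor
      · rintro ⟨hm, hc⟩
        have hc := Finset.mem_Icc.1 hc
        have h2 := (le_cons_last_iff hm).1 hc.2
        rw [mem_decreasingTuples] at hm ⊢
        exact ⟨⟨fun i => ⟨h2.2 i, (hm.1 i).2⟩, hm.2⟩, Finset.mem_Icc.2 ⟨hc.1, h2.1⟩⟩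
      · rintro ⟨hm, hc⟩
        have hc := Finset.mem_Icc.1 hc
        rw [mem_decreasingTuples] at hm
        have h2 : m ∈ decreasingTuples n 1 a := mem_decreasingTuples.2
          ⟨fun i => ⟨hc.1.trans (hm.1 i).1, (hm.1 i).2⟩, hm.2⟩
        exact ⟨h2, Finset.mem_Icc.2
          ⟨hc.1, (le_cons_last_iff h2).2 ⟨hc.2, fun i => (hm.1 i).1⟩⟩⟩
  rw [Finset.sum_congr rfl h1, Finset.sum_comm]
  refine Finset.sum_congr rfl fun a _ => ?_
  rw [Finset.sum_comm]
  refine Finset.sum_congr rfl fun c hc => ?_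
  rw [← Finset.mul_sum, Finset.sum_comm, partsBetween_succ (Finset.mem_Icc.1 hc).2]
  congr 1
  rw [Nat.cast_add, eval_add_natCast_sub]
  refine Finset.sum_congr rfl fun s _ => ?_
  rw [← eval_add_sum_eq (fun j => mult j lam) c (natDegree_backwardDiff hH), partsBetween,
    Nat.cast_sum, add_comm]

theorem hasWeightLE_doubleDiffSum {F H : ℚ[X]} {k d : ℕ} (hF : F.natDegree ≤ k)
    (hH : H.natDegree ≤ d) : HasWeightLE (doubleDiffSum F H) (k + d) := by
  cases d with
  | zero =>
    rw [eq_C_of_natDegree_le_zero hH]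
    convert hasWeightLE_zero _
    funext lam
    simp [doubleDiffSum]
  | succ d =>
    rw [doubleDiffSum_eq_sum_psiComponent F hH]
    refine HasWeightLE.sum fun n hn => hasWeightLE_psiComponent ?_
    have h1 := totalDegree_endpointPoly n F (backwardDiff^[n + 1] H)
    have hn := Finset.mem_range.1 hn
    -- The degree in the y-variables is at most d - n, which with the length n + 1 gives d + 1 for
    -- every n.
    have h2 := natDegree_iterate_backwardDiff (H := H) (d := d - n) (n + 1) (by omega)
    omega

end

/-! ### Midpoint sums and arm-leg moments -/

section

open Polynomial

/-- The polynomial `F` with `F(0) = 0` and `F(x + 1) - F(x) = (x + 1 / 2) ^ k`. -/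
noncomputable def midpointSum (k : ℕ) : ℚ[X] :=
  C (1 / ((k : ℚ) + 1)) * (taylor (1 / 2) (Polynomial.bernoulli (k + 1)) -
    C ((Polynomial.bernoulli (k + 1)).eval (1 / 2)))

lemma eval_midpointSum (k : ℕ) (x : ℚ) : (midpointSum k).eval x =
    1 / ((k : ℚ) + 1) * ((Polynomial.bernoulli (k + 1)).eval (x + 1 / 2) -
      (Polynomial.bernoulli (k + 1)).eval (1 / 2)) := by
  simp only [midpointSum, eval_mul, eval_C, eval_sub, taylor_eval]

lemma eval_midpointSum_zero (k : ℕ) : (midpointSum k).eval 0 = 0 := by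
  rw [eval_midpointSum, zero_add, sub_self, mul_zero]

lemma eval_midpointSum_add_one (k : ℕ) (x : ℚ) :
    (midpointSum k).eval (x + 1) - (midpointSum k).eval x = (x + 1 / 2) ^ k := by
  have h := bernoulli_eval_one_add (k + 1) (x + 1 / 2)
  rw [eval_midpointSum, eval_midpointSum, show x + 1 + 1 / 2 = 1 + (x + 1 / 2) by ring, h]
  have : (k : ℚ) + 1 ≠ 0 := by positivity
  push_cast
  field_simp
  simp

lemma eval_midpointSum_neg (k : ℕ) (x : ℚ) :
    (midpointSum k).eval (-x) = (-1) ^ (k + 1) * (midpointSum k).eval x := by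
  have h := bernoulli_eval_one_sub (k + 1) (1 / 2 + x)
  -- At the fixed point 1/2 of the reflection, the subtracted constant is seen to have the same
  -- parity.
  have h0 := bernoulli_eval_one_sub (k + 1) (1 / 2)
  rw [show (1 : ℚ) - 1 / 2 = 1 / 2 by norm_num] at h0
  rw [eval_midpointSum, eval_midpointSum, show -x + 1 / 2 = 1 - (1 / 2 + x) by ring, h,
    add_comm x]
  linear_combination (1 / ((k : ℚ) + 1)) * -h0

lemma natDegree_bernoulli_le (n : ℕ) : (Polynomial.bernoulli n).natDegree ≤ n := by
  rw [natDegree_le_iff_coeff_eq_zero]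
  intro i hi
  rw [coeff_bernoulli, if_neg (by omega)]

lemma natDegree_midpointSum_le (k : ℕ) : (midpointSum k).natDegree ≤ k + 1 := by
  refine (natDegree_C_mul_le _ _).trans ((natDegree_sub_C).le.trans ?_)
  rw [natDegree_taylor]
  exact natDegree_bernoulli_le _

lemma coeff_midpointSum (k : ℕ) : (midpointSum k).coeff (k + 1) = 1 / ((k : ℚ) + 1) := by
  have h1 : (Polynomial.bernoulli (k + 1)).coeff (k + 1) = 1 := by simp [coeff_bernoulli]
  have h2 : (Polynomial.bernoulli (k + 1)).natDegree = k + 1 :=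
    le_antisymm (natDegree_bernoulli_le _) (le_natDegree_of_ne_zero (by rw [h1]; exact one_ne_zero))
  have h3 := coeff_taylor_natDegree (1 / 2 : ℚ) (f := Polynomial.bernoulli (k + 1))
  rw [h2, leadingCoeff, h2, h1] at h3
  rw [midpointSum, coeff_C_mul, coeff_sub, h3, coeff_C_succ, sub_zero, mul_one]

/-- This cancellation of leading terms is what lowers the weight by one in the comparison with exp
P. -/
lemma natDegree_midpointSum_sub_le (k : ℕ) :
    (C (1 / (k ! : ℚ)) * midpointSum k - C (1 / ((k + 1)! : ℚ)) * X ^ (k + 1)).natDegree ≤ k := by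
  rw [natDegree_le_iff_coeff_eq_zero]
  intro i hi
  rw [coeff_sub, coeff_C_mul, coeff_C_mul_X_pow]
  split_ifs with h
  · rw [h, coeff_midpointSum, Nat.factorial_succ]
    push_cast
    have : (k ! : ℚ) ≠ 0 := by positivity
    field_simp
    simp
  · rw [coeff_eq_zero_of_natDegree_lt ((natDegree_midpointSum_le k).trans_lt (by omega))]
    simp

lemma sum_midpoint_pow (k r s : ℕ) :
    ∑ i ∈ Finset.range r, (((i + s : ℕ) : ℚ) + 1 / 2) ^ k =
      (midpointSum k).eval ((s + r : ℕ) : ℚ) - (midpointSum k).eval (s : ℚ) := by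
  induction r with
  | zero => simp
  | succ r ih =>
    have h := eval_midpointSum_add_one k ((r + s : ℕ) : ℚ)
    rw [Finset.sum_range_succ, ih, ← h]
    push_cast
    rw [show (s : ℚ) + (r + 1) = r + s + 1 by ring, add_comm (s : ℚ)]
    ring

/-- For fixed m and c the arm is constant and the legs run through the consecutive integers from
S(c, m) to S(c, m+1) - 1, so the sum of leg powers telescopes. -/
theorem sum_arm_pow_mul_leg_pow (a b : ℕ) (lam : Ptn) :
    ∑ c ∈ (young lam).cells, ((arm (young lam) c : ℚ) + 1 / 2) ^ a *
      ((leg (young lam) c : ℚ) + 1 / 2) ^ b =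
      doubleDiffSum (midpointSum a) (midpointSum b) lam := by
  rw [sum_arm_leg lam fun A B => ((A : ℚ) + 1 / 2) ^ a * ((B : ℚ) + 1 / 2) ^ b, doubleDiffSum]
  refine Finset.sum_congr rfl fun m _ => Finset.sum_congr rfl fun c hc => ?_
  have hc := (Finset.mem_Icc.1 hc).2
  rw [← Finset.mul_sum, sum_midpoint_pow, eval_midpointSum_add_one, Nat.cast_sub hc,
    partsBetween_succ hc]

lemma armLegMoment_monomial (q : ℚ) (a b : ℕ) :
    armLegMoment (MvPolynomial.C q * MvPolynomial.X 0 ^ a * MvPolynomial.X 1 ^ b) =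
      q • doubleDiffSum (midpointSum a) (midpointSum b) := by
  funext lam
  rw [Pi.smul_apply, ← sum_arm_pow_mul_leg_pow, armLegMoment, Finset.smul_sum]
  simp [mul_assoc]

lemma armLegMoment_eq_sum (g : MvPolynomial (Fin 2) ℚ) :
    armLegMoment g = ∑ d ∈ g.support,
      g.coeff d • doubleDiffSum (midpointSum (d 0)) (midpointSum (d 1)) := by
  funext lam
  simp only [armLegMoment, MvPolynomial.eval_eq', Fin.prod_univ_two, Finset.sum_apply,
    Pi.smul_apply, ← sum_arm_pow_mul_leg_pow, smul_eq_mul, Finset.mul_sum]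
  rw [Finset.sum_comm]
  rfl

theorem hasWeightLE_armLegMoment (g : MvPolynomial (Fin 2) ℚ) :
    HasWeightLE (armLegMoment g) (g.totalDegree + 2) := by
  rw [armLegMoment_eq_sum]
  refine HasWeightLE.sum fun d hd => HasWeightLE.smul ?_ _
  refine (hasWeightLE_doubleDiffSum (natDegree_midpointSum_le (d 0))
    (natDegree_midpointSum_le (d 1))).mono ?_
  have h := MvPolynomial.le_totalDegree hd
  rw [Finsupp.sum_fintype _ _ (fun _ => rfl), Fin.sum_univ_two] at h
  omega

end

/-! ### The exp P functions and the leading term -/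

section

/-- The weakly decreasing `n`-tuples with entries in `[c, N)`. -/
def antitoneTuples (n c N : ℕ) : Finset (Fin n → ℕ) :=
  {m ∈ Fintype.piFinset fun _ : Fin n => Finset.Ico c N | ∀ i j, i ≤ j → m j ≤ m i}

lemma mem_antitoneTuples {n c N : ℕ} {m : Fin n → ℕ} :
    m ∈ antitoneTuples n c N ↔ (∀ i, c ≤ m i ∧ m i < N) ∧ ∀ i j, i ≤ j → m j ≤ m i := by
  simp [antitoneTuples]

lemma weakTuples_eq (n N : ℕ) : weakTuples n N = antitoneTuples n 1 (N + 1) := by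
  rw [weakTuples, antitoneTuples, Finset.Ico_add_one_right_eq_Icc]

/-- Identifies the weight 1/Aut(m) with a multinomial coefficient divided by n!. -/
lemma countPerms_mul_aut {n : ℕ} (m : Fin n → ℕ) :
    aut m * ((Finset.univ : Finset (Fin n)).val.map m).countPerms = n ! := by
  have h1 : ∀ j, Multiset.count j ((Finset.univ : Finset (Fin n)).val.map m) =
      Finset.card {i | m i = j} := by
    intro j
    rw [Multiset.count_map, Finset.card_def, Finset.filter_val]
    simp [eq_comm]
  rw [Multiset.countPerms, Finsupp.multinomial_eq_of_support_subset
    (s := Finset.univ.image m), aut]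
  · simp_rw [← h1]
    refine (Nat.multinomial_spec _ _).trans ?_
    congr 1
    simp only [h1]
    rw [← Finset.card_eq_sum_card_image]
    simp
  · intro j
    simp

/-- This is the multinomial theorem: weakly decreasing tuples are the sorted representatives of
multisets of size n. -/
theorem sum_antitoneTuples (n c N : ℕ) (x : ℕ → ℚ) :
    ∑ m ∈ antitoneTuples n c N, 1 / (aut m : ℚ) * ∏ j, x (m j) =
      (∑ j ∈ Finset.Ico c N, x j) ^ n / (n ! : ℚ) := by
  rw [Finset.sum_pow, Finset.sum_div]
  refine Finset.sum_bij (fun m _ => Sym.mk (Finset.univ.val.map m) (by simp)) ?_ ?_ ?_ ?_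
  · intro m hm
    rw [Finset.mem_sym_iff]
    intro a ha
    obtain ⟨i, -, rfl⟩ := Multiset.mem_map.1 ((Sym.mem_mk _ _ _).1 ha)
    exact Finset.mem_Ico.2 ((mem_antitoneTuples.1 hm).1 i)
  · intro m hm m' hm' h
    have h1 := congrArg Subtype.val h
    simp only [Fin.univ_val_map, Multiset.coe_eq_coe] at h1
    have hs : ∀ {m : Fin n → ℕ}, m ∈ antitoneTuples n c N → (List.ofFn m).SortedGE := fun hm =>
      List.sortedGE_ofFn_iff.2 fun i j hij => (mem_antitoneTuples.1 hm).2 i j hij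
    exact List.ofFn_injective (h1.eq_of_sortedGE (hs hm) (hs hm'))
  · rintro ⟨s, hs⟩ hmem
    have hlen : (s.sort (· ≥ ·)).length = n := by rw [Multiset.length_sort, hs]
    refine ⟨fun i => (s.sort (· ≥ ·)).get (i.cast hlen.symm), ?_, ?_⟩
    · rw [mem_antitoneTuples]
      constructor
      · intro i
        refine Finset.mem_Ico.1 (Finset.mem_sym_iff.1 hmem _ ?_)
        exact (Multiset.mem_sort (· ≥ ·)).1 (List.get_mem _ _)
      · intro i j hij
        exact (s.pairwise_sort (· ≥ ·)).sortedGE.antitone_get hij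
    · refine Subtype.ext ?_
      subst hlen
      simp only [Fin.univ_val_map]
      change (List.ofFn (s.sort (· ≥ ·)).get : Multiset ℕ) = s
      rw [List.ofFn_get, Multiset.sort_eq]
  · intro m _
    have h1 := countPerms_mul_aut m
    have h2 : (aut m : ℚ) ≠ 0 := fun h0 => by
      rw [Nat.cast_eq_zero] at h0
      rw [h0, zero_mul] at h1
      exact Nat.factorial_ne_zero n h1.symm
    rw [← h1]
    have h3 : (((Finset.univ : Finset (Fin n)).val.map m).countPerms : ℚ) ≠ 0 := fun h0 => by
      rw [Nat.cast_eq_zero] at h0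
      rw [h0, mul_zero] at h1
      exact Nat.factorial_ne_zero n h1.symm
    simp only [Multiset.map_map, Nat.cast_mul, Function.comp_def]
    change _ = _ * (∏ j, x (m j)) / _
    field_simp

open Polynomial

lemma antitoneTuples_filter_ne (b c a : ℕ) :
    {m ∈ antitoneTuples (b + 1) c (a + 1) | ¬ m 0 = a} = antitoneTuples (b + 1) c a := by
  ext m
  rw [Finset.mem_filter, mem_antitoneTuples, mem_antitoneTuples]
  constructor
  · rintro ⟨⟨h1, h2⟩, h3⟩
    refine ⟨fun i => ⟨(h1 i).1, (h2 0 i (Fin.zero_le i)).trans_lt ?_⟩, h2⟩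
    have := (h1 0).2
    omega
  · rintro ⟨h1, h2⟩
    exact ⟨⟨fun i => ⟨(h1 i).1, (h1 i).2.trans (Nat.lt_succ_self a)⟩, h2⟩, (h1 0).2.ne⟩

/-- The end-point factor is unfolded into a sum over c up to the last entry. The tuples in [c, a]
with first entry a are all those in [c, a + 1) minus those in [c, a), so `sum_antitoneTuples` gives
a difference of powers of S(c, a + 1) and S(c, a). -/
theorem sum_weakTuples_endpoints (F : ℚ[X]) (b : ℕ) (lam : Ptn) :
    ∑ m ∈ weakTuples (b + 1) lam.1, (1 / (aut m : ℚ) * ∏ j, (mult (m j) lam : ℚ)) *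
        (F.eval (m 0 : ℚ) - F.eval ((m 0 : ℚ) - (m (Fin.last b) : ℚ))) =
      doubleDiffSum F (C (1 / ((b + 1)! : ℚ)) * X ^ (b + 1)) lam := by
  set w : (Fin (b + 1) → ℕ) → ℚ := fun m => 1 / (aut m : ℚ) * ∏ j, (mult (m j) lam : ℚ) with hw
  have hmaps : ∀ m ∈ antitoneTuples (b + 1) 1 (lam.1 + 1), m 0 ∈ Finset.Icc 1 lam.1 := by
    intro m hm
    have := (mem_antitoneTuples.1 hm).1 0
    rw [Finset.mem_Icc]
    omega
  rw [weakTuples_eq, ← Finset.sum_fiberwise_of_maps_to hmaps, doubleDiffSum]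
  refine Finset.sum_congr rfl fun a ha => ?_
  have ha := Finset.mem_Icc.1 ha
  have h1 : ∀ m ∈ (antitoneTuples (b + 1) 1 (lam.1 + 1)).filter (fun m => m 0 = a),
      (1 / (aut m : ℚ) * ∏ j, (mult (m j) lam : ℚ)) *
        (F.eval (m 0 : ℚ) - F.eval ((m 0 : ℚ) - (m (Fin.last b) : ℚ))) =
      ∑ c ∈ Finset.Icc 1 (m (Fin.last b)),
        (F.eval ((a : ℚ) - c + 1) - F.eval ((a : ℚ) - c)) * w m := by
    intro m hm
    rw [← Finset.sum_mul, sum_Icc_sub_telescope, (Finset.mem_filter.1 hm).2, mul_comm]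
  rw [Finset.sum_congr rfl h1, Finset.sum_comm' (t' := Finset.Icc 1 a)
    (s' := fun c => (antitoneTuples (b + 1) c (a + 1)).filter (fun m => m 0 = a))]
  · refine Finset.sum_congr rfl fun c hc => ?_
    rw [← Finset.mul_sum]
    congr 1
    have h2 := Finset.sum_filter_add_sum_filter_not (antitoneTuples (b + 1) c (a + 1))
      (fun m => m 0 = a) w
    rw [antitoneTuples_filter_ne, sum_antitoneTuples (b + 1) c (a + 1) (fun j => (mult j lam : ℚ)),
      sum_antitoneTuples (b + 1) c a (fun j => (mult j lam : ℚ))] at h2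
    rw [eq_sub_of_add_eq h2]
    simp only [partsBetween, Nat.cast_sum, eval_mul, eval_C, eval_pow, eval_X]
    ring
  · intro m c
    simp only [Finset.mem_filter, mem_antitoneTuples, Finset.mem_Icc]
    constructor
    · rintro ⟨⟨⟨h2, h3⟩, h4⟩, h5, h6⟩
      have h7 : ∀ i, c ≤ m i := fun i => h6.trans (h3 i _ (Fin.le_last i))
      refine ⟨⟨⟨fun i => ⟨h7 i, ?_⟩, h3⟩, h4⟩, h5, h4 ▸ h7 0⟩
      have := h3 0 i (Fin.zero_le i)
      omega
    · rintro ⟨⟨⟨h2, h3⟩, h4⟩, h5, h6⟩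
      refine ⟨⟨⟨fun i => ⟨h5.trans (h2 i).1, ?_⟩, h3⟩, h4⟩, h5, (h2 _).1⟩
      have := (h2 i).2
      omega

/-- The comparison involves f₁ only, and the normalization determines it; hence independence of the
chosen sequence. -/
lemma IsWellNormalized.eval_one {F : ℕ → ℚ[X]} (hF : IsWellNormalized F) (x : ℚ) :
    (F 1).eval x = x := by
  obtain ⟨h1, h2, h3⟩ := hF 1
  have h4 : (F 1).natDegree = 1 := natDegree_eq_of_degree_eq_some h1
  have h5 := eq_X_add_C_of_degree_le_one h1.le
  rw [leadingCoeff, h4] at h2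
  rw [← coeff_zero_eq_eval_zero] at h3
  rw [h5, h2, h3 le_rfl]
  simp

lemma prod_pow_endVector {b : ℕ} (i e : ℕ) (x : Fin (b + 1) → ℚ) :
    ∏ j, x j ^ endVector b i e j = x 0 ^ i * x (Fin.last b) ^ e := by
  simp_rw [endVector, pow_add, Finset.prod_mul_distrib]
  congr 1 <;> simp [pow_ite]

/-- Binomial expansion of (x - y)^(a+1), whose top term i = a + 1 cancels against x^(a+1). -/
lemma sum_div_factorial_mul_pow (a : ℕ) (x y : ℚ) :
    ∑ i ∈ Finset.range (a + 1), (-1 : ℚ) ^ (a - i) / ((i ! : ℚ) * ((a + 1 - i)! : ℚ)) *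
      (x ^ i * y ^ (a + 1 - i)) =
      1 / ((a + 1)! : ℚ) * x ^ (a + 1) - 1 / ((a + 1)! : ℚ) * (x - y) ^ (a + 1) := by
  have h := add_pow x (-y) (a + 1)
  rw [Finset.sum_range_succ] at h
  rw [sub_eq_add_neg x y, h, mul_add, Finset.mul_sum]
  simp only [Nat.sub_self, pow_zero, mul_one, Nat.choose_self, Nat.cast_one]
  rw [sub_add_cancel_right, ← Finset.sum_neg_distrib]
  refine Finset.sum_congr rfl fun i hi => ?_
  have hi := Finset.mem_range_succ_iff.1 hi
  rw [Nat.cast_choose ℚ (show i ≤ a + 1 by omega), neg_pow y, Nat.succ_sub hi, pow_succ]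
  have h1 : ((a + 1)! : ℚ) ≠ 0 := by positivity
  have h2 : (i ! : ℚ) ≠ 0 := by positivity
  have h3 : (((a - i).succ)! : ℚ) ≠ 0 := by positivity
  field_simp
  rw [Nat.succ_eq_add_one, pow_succ (-1 : ℚ)]
  ring

theorem sum_expP_eq {F : ℕ → ℚ[X]} (hF : IsWellNormalized F) (a b : ℕ) :
    ∑ i ∈ Finset.range (a + 1), ((-1 : ℚ) ^ (a - i) / ((i ! : ℚ) * ((a + 1 - i)! : ℚ))) •
        expP F (fun _ : Fin (b + 1) => 1) (endVector b i (a + 1 - i)) =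
      doubleDiffSum (C (1 / ((a + 1)! : ℚ)) * X ^ (a + 1))
        (C (1 / ((b + 1)! : ℚ)) * X ^ (b + 1)) := by
  funext lam
  rw [← sum_weakTuples_endpoints, Finset.sum_apply]
  simp only [Pi.smul_apply, expP, smul_eq_mul, hF.eval_one, Finset.prod_mul_distrib,
    Finset.mul_sum]
  rw [Finset.sum_comm]
  refine Finset.sum_congr rfl fun m _ => ?_
  simp only [eval_mul, eval_C, eval_pow, eval_X]
  rw [← sum_div_factorial_mul_pow, Finset.mul_sum]
  refine Finset.sum_congr rfl fun i _ => ?_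
  rw [prod_pow_endVector i (a + 1 - i) fun j => (m j : ℚ)]
  ring

theorem hasWeightLE_armLegMoment_sub_expP {F : ℕ → ℚ[X]} (hF : IsWellNormalized F) (a b : ℕ) :
    HasWeightLE
      (armLegMoment
          (MvPolynomial.C (1 / ((a ! : ℚ) * (b ! : ℚ))) *
            MvPolynomial.X 0 ^ a * MvPolynomial.X 1 ^ b) -
        ∑ i ∈ Finset.range (a + 1),
          ((-1 : ℚ) ^ (a - i) / ((i ! : ℚ) * ((a + 1 - i)! : ℚ))) •
            expP F (fun _ : Fin (b + 1) => 1) (endVector b i (a + 1 - i)))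
      (a + b + 1) := by
  have hC : ∀ k : ℕ, (C (1 / ((k + 1)! : ℚ)) * X ^ (k + 1)).natDegree ≤ k + 1 := fun k =>
    natDegree_C_mul_X_pow_le _ _
  have hM : ∀ k : ℕ, (C (1 / (k ! : ℚ)) * midpointSum k).natDegree ≤ k + 1 := fun k =>
    (natDegree_C_mul_le _ _).trans (natDegree_midpointSum_le k)
  -- Bilinearity in the form D(F, H) - D(F', H') = D(F - F', H) + D(F', H - H'); each term has one
  -- argument of lowered degree.
  have h : armLegMoment (MvPolynomial.C (1 / ((a ! : ℚ) * (b ! : ℚ))) *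
        MvPolynomial.X 0 ^ a * MvPolynomial.X 1 ^ b) -
      doubleDiffSum (C (1 / ((a + 1)! : ℚ)) * X ^ (a + 1))
        (C (1 / ((b + 1)! : ℚ)) * X ^ (b + 1)) =
      doubleDiffSum (C (1 / (a ! : ℚ)) * midpointSum a - C (1 / ((a + 1)! : ℚ)) * X ^ (a + 1))
        (C (1 / (b ! : ℚ)) * midpointSum b) +
      doubleDiffSum (C (1 / ((a + 1)! : ℚ)) * X ^ (a + 1))
        (C (1 / (b ! : ℚ)) * midpointSum b - C (1 / ((b + 1)! : ℚ)) * X ^ (b + 1)) := by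
    rw [armLegMoment_monomial, doubleDiffSum_sub_left, doubleDiffSum_sub_right,
      doubleDiffSum_C_mul_left (1 / (a ! : ℚ)),
      doubleDiffSum_C_mul_right (1 / (b ! : ℚ)) (midpointSum a),
      smul_smul, one_div_mul_one_div]
    abel
  rw [sum_expP_eq hF, h]
  refine HasWeightLE.add ?_ ?_
  · exact (hasWeightLE_doubleDiffSum (natDegree_midpointSum_sub_le a) (hM b)).mono (by omega)
  · exact (hasWeightLE_doubleDiffSum (hC a) (natDegree_midpointSum_sub_le b)).mono (by omega)

end

/-! ### Generating series of cells with prescribed arm and leg -/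

section GeneratingFunction

/-- The generating series `∑_lam f(lam) X^|lam|`. -/
noncomputable def partitionSeries : (Ptn → ℚ) →ₗ[ℚ] ℚ⟦X⟧ where
  toFun f := PowerSeries.mk fun n => ∑ p : Nat.Partition n, f ⟨n, p⟩
  map_add' f g := by
    ext n
    simp [Finset.sum_add_distrib]
  map_smul' a f := by
    ext n
    simp [Finset.mul_sum]

lemma coeff_partitionSeries (f : Ptn → ℚ) (n : ℕ) :
    PowerSeries.coeff n (partitionSeries f) = ∑ p : Nat.Partition n, f ⟨n, p⟩ := by
  have h : partitionSeries f = PowerSeries.mk fun n => ∑ p : Nat.Partition n, f ⟨n, p⟩ := rfl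
  rw [h, PowerSeries.coeff_mk]

/-- The partition with an additional part `m`. -/
def addPart (m : ℕ) (hm : 0 < m) (lam : Ptn) : Ptn :=
  ⟨lam.1 + m,
    { parts := m ::ₘ lam.2.parts
      parts_pos := fun {i} hi => by
        rcases Multiset.mem_cons.1 hi with rfl | hi
        · exact hm
        · exact lam.2.parts_pos hi
      parts_sum := by rw [Multiset.sum_cons, lam.2.parts_sum, add_comm] }⟩

lemma mult_addPart (j m : ℕ) (hm : 0 < m) (lam : Ptn) :
    mult j (addPart m hm lam) = mult j lam + if j = m then 1 else 0 :=
  Multiset.count_cons _ _ _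

lemma partsBetween_addPart (c N m : ℕ) (hm : 0 < m) (lam : Ptn) :
    partsBetween c N (addPart m hm lam) =
      partsBetween c N lam + if c ≤ m ∧ m < N then 1 else 0 := by
  simp only [partsBetween, mult_addPart, Finset.sum_add_distrib, Finset.sum_ite_eq',
    Finset.mem_Ico]

/-- Removing one part m is a bijection from the partitions containing m to all partitions. -/
lemma partitionSeries_ite_mult_pos (m : ℕ) (hm : 0 < m) (f : Ptn → ℚ) :
    partitionSeries (fun lam => if 0 < mult m lam then f lam else 0) =
      PowerSeries.X ^ m * partitionSeries fun lam => f (addPart m hm lam) := by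
  ext n
  rw [coeff_partitionSeries, PowerSeries.coeff_X_pow_mul']
  split_ifs with h
  · obtain ⟨k, rfl⟩ := Nat.exists_eq_add_of_le' h
    rw [Nat.add_sub_cancel, coeff_partitionSeries, ← Finset.sum_filter]
    symm
    refine Finset.sum_bij (fun q _ => (addPart m hm ⟨k, q⟩).2) ?_ ?_ ?_ ?_
    · intro q _
      refine Finset.mem_filter.2 ⟨Finset.mem_univ _, ?_⟩
      change 0 < mult m (addPart m hm ⟨k, q⟩)
      rw [mult_addPart, if_pos rfl]
      omega
    · intro q _ q' _ hq
      have h1 := congrArg Nat.Partition.parts hq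
      exact Nat.Partition.ext ((Multiset.cons_inj_right m).1 h1)
    · intro p hp
      have hp : m ∈ p.parts := Multiset.count_pos.1 (Finset.mem_filter.1 hp).2
      have h1 := Multiset.cons_erase hp
      refine ⟨⟨p.parts.erase m, fun hi => p.parts_pos (Multiset.mem_of_mem_erase hi), ?_⟩,
        Finset.mem_univ _, Nat.Partition.ext h1⟩
      have h2 := congrArg Multiset.sum h1
      rw [Multiset.sum_cons, p.parts_sum] at h2
      omega
    · intro q _
      rfl
  · refine Finset.sum_eq_zero fun p _ => if_neg ?_
    rw [mult_eq_zero (lam := ⟨n, p⟩) (not_le.1 h)]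
    exact lt_irrefl 0

lemma partitionSeries_ite_mult_zero (m : ℕ) (hm : 0 < m) (f : Ptn → ℚ) :
    partitionSeries (fun lam => if mult m lam = 0 then f lam else 0) =
      partitionSeries f - PowerSeries.X ^ m * partitionSeries fun lam => f (addPart m hm lam) := by
  rw [← partitionSeries_ite_mult_pos, ← map_sub]
  congr 1
  funext lam
  rcases Nat.eq_zero_or_pos (mult m lam) with h | h
  · simp [h]
  · simp [h, h.ne']

/-- The generating series of the partitions with exactly `j` parts in `[c, c + A)`. -/
noncomputable def exactSeries (c A j : ℕ) : ℚ⟦X⟧ :=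
  partitionSeries fun lam => if partsBetween c (c + A) lam = j then 1 else 0

/-- The generating series of the partitions with a cell in column `c` of arm length `A` and
leg length `B`. -/
noncomputable def cellSeries (c A B : ℕ) : ℚ⟦X⟧ :=
  partitionSeries fun lam =>
    if partsBetween c (c + A) lam ≤ B ∧ B < partsBetween c (c + A + 1) lam then 1 else 0

lemma exactSeries_zero (c j : ℕ) :
    exactSeries c 0 j = if j = 0 then partitionSeries 1 else 0 := by
  have h : ∀ lam, partsBetween c c lam = 0 := fun lam => by simp [partsBetween]
  split_ifs with hj
  · subst hj
    simp only [exactSeries, add_zero, h, if_true]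
    rfl
  · simp only [exactSeries, add_zero, h, Ne.symm hj, if_false]
    exact map_zero partitionSeries

lemma partitionSeries_split (m : ℕ) (f : Ptn → ℚ) :
    partitionSeries f = partitionSeries (fun lam => if mult m lam = 0 then f lam else 0) +
      partitionSeries (fun lam => if 0 < mult m lam then f lam else 0) := by
  rw [← map_add]
  congr 1
  funext lam
  rcases Nat.eq_zero_or_pos (mult m lam) with h | h
  · simp [h]
  · simp [h, h.ne']

lemma exactSeries_ite_mult_zero {c : ℕ} (hc : 0 < c) (A j : ℕ) :
    partitionSeries (fun lam => if mult (c + A) lam = 0 then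
        (if partsBetween c (c + A + 1) lam = j then 1 else 0) else 0) =
      (1 - PowerSeries.X ^ (c + A)) * exactSeries c A j := by
  have h := partitionSeries_ite_mult_zero (c + A) (by omega)
    (fun lam => if partsBetween c (c + A) lam = j then 1 else 0)
  simp only [partsBetween_addPart, lt_self_iff_false, and_false, if_false, add_zero] at h
  rw [sub_mul, one_mul, exactSeries, ← h]
  congr 1
  funext lam
  rw [partsBetween_succ (Nat.le_add_right c A)]
  split_ifs <;> simp_all

lemma exactSeries_succ_zero {c : ℕ} (hc : 0 < c) (A : ℕ) :
    exactSeries c (A + 1) 0 = (1 - PowerSeries.X ^ (c + A)) * exactSeries c A 0 := by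
  rw [exactSeries, partitionSeries_split (c + A), ← add_assoc, exactSeries_ite_mult_zero hc,
    partitionSeries_ite_mult_pos (c + A) (by omega)]
  simp only [partsBetween_addPart]
  rw [if_pos ⟨Nat.le_add_right c A, Nat.lt_succ_self _⟩]
  simp only [Nat.add_eq_zero_iff, one_ne_zero, and_false, if_false]
  have h0 : partitionSeries (fun _ => 0) = 0 := map_zero partitionSeries
  rw [h0, mul_zero, add_zero]

lemma exactSeries_succ_succ {c : ℕ} (hc : 0 < c) (A j : ℕ) :
    exactSeries c (A + 1) (j + 1) = (1 - PowerSeries.X ^ (c + A)) * exactSeries c A (j + 1) +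
      PowerSeries.X ^ (c + A) * exactSeries c (A + 1) j := by
  rw [exactSeries, partitionSeries_split (c + A), ← add_assoc, exactSeries_ite_mult_zero hc,
    partitionSeries_ite_mult_pos (c + A) (by omega)]
  simp only [partsBetween_addPart]
  rw [if_pos ⟨Nat.le_add_right c A, Nat.lt_succ_self _⟩]
  simp only [Nat.add_right_cancel_iff]
  rfl

/-- Such a cell forces c + A to be a part. Removing one copy lowers S(c, c+A+1) by one and keeps
S(c, c+A), so the new condition B < S(c, c+A+1) + 1 splits into the old one and equality. -/
lemma one_sub_mul_cellSeries {c : ℕ} (hc : 0 < c) (A B : ℕ) :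
    (1 - PowerSeries.X ^ (c + A)) * cellSeries c A B =
      PowerSeries.X ^ (c + A) * exactSeries c (A + 1) B := by
  have h1 : cellSeries c A B = PowerSeries.X ^ (c + A) *
      (cellSeries c A B + exactSeries c (A + 1) B) := by
    have h2 : cellSeries c A B = partitionSeries (fun lam => if 0 < mult (c + A) lam then
        (if partsBetween c (c + A) lam ≤ B ∧ B < partsBetween c (c + A + 1) lam then 1 else 0)
          else 0) := by
      rw [cellSeries]
      congr 1
      funext lam
      rw [partsBetween_succ (Nat.le_add_right c A)]
      split_ifs <;> first | rfl | omega
    refine h2.trans ?_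
    rw [partitionSeries_ite_mult_pos (c + A) (by omega), cellSeries, exactSeries,
      ← map_add]
    congr 2
    funext lam
    simp only [partsBetween_addPart, Pi.add_apply, lt_self_iff_false, and_false, if_false, add_zero]
    have h3 : c ≤ c + A ∧ c + A < c + A + 1 := ⟨Nat.le_add_right c A, Nat.lt_succ_self _⟩
    rw [if_pos h3, ← add_assoc c A 1,
      partsBetween_succ (Nat.le_add_right c A)]
    split_ifs <;> first | simp; done | omega
  linear_combination h1

/-- The `q`-Pochhammer symbol `(q ^ s; q)_n`. -/
noncomputable def qPochhammer (s n : ℕ) : ℚ⟦X⟧ :=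
  ∏ i ∈ Finset.range n, (1 - PowerSeries.X ^ (s + i))

lemma qPochhammer_zero (s : ℕ) : qPochhammer s 0 = 1 := Finset.prod_range_zero _

lemma qPochhammer_succ (s n : ℕ) :
    qPochhammer s (n + 1) = qPochhammer s n * (1 - PowerSeries.X ^ (s + n)) :=
  Finset.prod_range_succ _ _

lemma qPochhammer_succ' (s n : ℕ) :
    qPochhammer s (n + 1) = (1 - PowerSeries.X ^ s) * qPochhammer (s + 1) n := by
  rw [qPochhammer, Finset.prod_range_succ', mul_comm, add_zero]
  congr 1
  exact Finset.prod_congr rfl fun i _ => by rw [add_assoc, add_comm 1 i]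

lemma qPochhammer_add (s m n : ℕ) :
    qPochhammer s (m + n) = qPochhammer s m * qPochhammer (s + m) n := by
  rw [qPochhammer, Finset.prod_range_add]
  simp only [← add_assoc]
  rfl

lemma constantCoeff_qPochhammer {s : ℕ} (hs : 0 < s) (n : ℕ) :
    PowerSeries.constantCoeff (qPochhammer s n) = 1 := by
  rw [qPochhammer, map_prod]
  refine Finset.prod_eq_one fun i _ => ?_
  rw [map_sub, map_one, map_pow, PowerSeries.constantCoeff_X, zero_pow (by omega), sub_zero]

lemma isUnit_qPochhammer {s : ℕ} (hs : 0 < s) (n : ℕ) : IsUnit (qPochhammer s n) := by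
  rw [PowerSeries.isUnit_iff_constantCoeff, constantCoeff_qPochhammer hs]
  exact isUnit_one

lemma one_sub_X_pow_ne_zero {m : ℕ} (hm : 0 < m) : (1 - PowerSeries.X ^ m : ℚ⟦X⟧) ≠ 0 := by
  have h := (isUnit_qPochhammer hm 1).ne_zero
  rwa [qPochhammer_succ, qPochhammer_zero, one_mul, add_zero] at h

/-- Up to the factor `partitionSeries 1` times q^(cj) (q^c; q)_A, `exactSeries` is the q-binomial
coefficient of A + j - 1 over j, stated without denominators. The recursions in A and j are a form
of the q-Pascal rule. -/
lemma qPochhammer_mul_exactSeries {c : ℕ} (hc : 0 < c) (A j : ℕ) :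
    qPochhammer 1 j * exactSeries c A j =
      partitionSeries 1 * PowerSeries.X ^ (c * j) * qPochhammer c A * qPochhammer A j := by
  induction A generalizing j with
  | zero =>
    rw [exactSeries_zero]
    cases j with
    | zero => simp [qPochhammer_zero]
    -- With A = 0 the right side contains 1 - q^0 = 0.
    | succ j => simp [qPochhammer_succ']
  | succ A ihA =>
    induction j with
    | zero =>
      have h := ihA 0
      rw [exactSeries_succ_zero hc, qPochhammer_succ]
      simp only [qPochhammer_zero] at h ⊢
      linear_combination (1 - PowerSeries.X ^ (c + A)) * h
    | succ j ihj =>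
      have h := ihA (j + 1)
      rw [exactSeries_succ_succ hc]
      rw [qPochhammer_succ' A j] at h
      rw [qPochhammer_succ (A + 1) j, qPochhammer_succ c A]
      rw [qPochhammer_succ 1 j] at h ⊢
      rw [qPochhammer_succ c A] at ihj
      linear_combination (1 - PowerSeries.X ^ (c + A)) * h +
        PowerSeries.X ^ (c + A) * (1 - PowerSeries.X ^ (1 + j)) * ihj

lemma qPochhammer_mul_cellSeries {c : ℕ} (hc : 0 < c) (A B : ℕ) :
    qPochhammer 1 B * cellSeries c A B =
      partitionSeries 1 * PowerSeries.X ^ A * qPochhammer (A + 1) B *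
        (PowerSeries.X ^ (c * (B + 1)) * qPochhammer c A) := by
  refine mul_left_cancel₀ (one_sub_X_pow_ne_zero (show 0 < c + A by omega)) ?_
  have h1 := one_sub_mul_cellSeries hc A B
  have h2 := qPochhammer_mul_exactSeries hc (A + 1) B
  rw [qPochhammer_succ c A] at h2
  linear_combination qPochhammer 1 B * h1 + PowerSeries.X ^ (c + A) * h2

/-- Truncation of ∑_{c ≥ 1} q^(c(B+1)) (q^c; q)_A = q^(B+1) (q; q)_A / (q^(B+1); q)_(A+1); the
congruence modulo q^(C+1) avoids infinite sums. The case A = 0 is a geometric series, and the last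
factor 1 - q^(c+A) of (q^c; q)_(A+1) reduces A + 1 to A at B and B + 1. -/
lemma X_pow_dvd_qPochhammer_mul_sum (C A B : ℕ) :
    (PowerSeries.X : ℚ⟦X⟧) ^ (C + 1) ∣ qPochhammer (B + 1) (A + 1) *
        ∑ c ∈ Finset.Icc 1 C, PowerSeries.X ^ (c * (B + 1)) * qPochhammer c A -
      PowerSeries.X ^ (B + 1) * qPochhammer 1 A := by
  induction A generalizing B with
  | zero =>
    have h : ∀ C : ℕ, (1 - (PowerSeries.X : ℚ⟦X⟧) ^ (B + 1)) *
        ∑ c ∈ Finset.Icc 1 C, PowerSeries.X ^ (c * (B + 1)) =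
        PowerSeries.X ^ (B + 1) - PowerSeries.X ^ ((C + 1) * (B + 1)) := by
      intro C
      induction C with
      | zero => simp
      | succ C ih =>
        rw [Finset.sum_Icc_succ_top (by omega), mul_add, ih]
        ring
    simp only [qPochhammer_succ, qPochhammer_zero, one_mul, mul_one, add_zero, zero_add]
    rw [h, sub_sub_cancel_left, dvd_neg]
    exact pow_dvd_pow _ (Nat.le_mul_of_pos_right _ (Nat.succ_pos B))
  | succ A ih =>
    obtain ⟨u, hu⟩ := ih B
    obtain ⟨v, hv⟩ := ih (B + 1)
    have h1 : ∑ c ∈ Finset.Icc 1 C, (PowerSeries.X : ℚ⟦X⟧) ^ (c * (B + 1)) *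
          qPochhammer c (A + 1) =
        ∑ c ∈ Finset.Icc 1 C, PowerSeries.X ^ (c * (B + 1)) * qPochhammer c A -
        PowerSeries.X ^ A *
          ∑ c ∈ Finset.Icc 1 C, PowerSeries.X ^ (c * (B + 1 + 1)) * qPochhammer c A := by
      rw [Finset.mul_sum, ← Finset.sum_sub_distrib]
      refine Finset.sum_congr rfl fun c _ => ?_
      rw [qPochhammer_succ]
      ring
    -- The multipliers are the last and the first factor of (q^(B+1); q)_(A+2), split off to match
    -- the two induction hypotheses.
    refine ⟨(1 - PowerSeries.X ^ (B + 1 + (A + 1))) * u -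
      PowerSeries.X ^ A * (1 - PowerSeries.X ^ (B + 1)) * v, ?_⟩
    have h2 := qPochhammer_succ' (B + 1) (A + 1)
    have h3 := qPochhammer_succ (B + 1) (A + 1)
    rw [h1, mul_sub]
    nth_rewrite 2 [h2]
    rw [h3, qPochhammer_succ 1 A]
    linear_combination (1 - PowerSeries.X ^ (B + 1 + (A + 1))) * hu -
      PowerSeries.X ^ A * (1 - PowerSeries.X ^ (B + 1)) * hv

lemma X_pow_dvd_sum_cellSeries (C A B : ℕ) :
    (PowerSeries.X : ℚ⟦X⟧) ^ (C + 1) ∣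
      (1 - PowerSeries.X ^ (A + B + 1)) * ∑ c ∈ Finset.Icc 1 C, cellSeries c A B -
        partitionSeries 1 * PowerSeries.X ^ (A + B + 1) := by
  obtain ⟨u, hu⟩ := X_pow_dvd_qPochhammer_mul_sum C A B
  -- After multiplication by (q; q)_(A+B) all Pochhammer symbols combine, and only A + B remains.
  refine (isUnit_qPochhammer one_pos (A + B)).dvd_mul_left.1 ?_
  have h1 : qPochhammer 1 B * ∑ c ∈ Finset.Icc 1 C, cellSeries c A B =
      partitionSeries 1 * PowerSeries.X ^ A * qPochhammer (A + 1) B *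
        ∑ c ∈ Finset.Icc 1 C, PowerSeries.X ^ (c * (B + 1)) * qPochhammer c A := by
    rw [Finset.mul_sum, Finset.mul_sum]
    refine Finset.sum_congr rfl fun c hc => ?_
    exact qPochhammer_mul_cellSeries (Finset.mem_Icc.1 hc).1 A B
  have h2 := qPochhammer_add 1 B (A + 1)
  have h3 := qPochhammer_add 1 A B
  have h4 := qPochhammer_succ 1 (A + B)
  rw [show B + (A + 1) = A + B + 1 by ring, h4, add_comm 1 B] at h2
  rw [add_comm 1 A] at h3
  refine ⟨partitionSeries 1 * PowerSeries.X ^ A * qPochhammer (A + 1) B * u, ?_⟩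
  rw [add_comm 1 (A + B)] at h2
  linear_combination (∑ c ∈ Finset.Icc 1 C, cellSeries c A B) * h2 +
    qPochhammer (B + 1) (A + 1) * h1 +
    partitionSeries 1 * PowerSeries.X ^ A * qPochhammer (A + 1) B * hu -
    partitionSeries 1 * PowerSeries.X ^ (A + B + 1) * h3

end GeneratingFunction

/-! ### Hook lengths and divisor sums -/

lemma sum_range_ite_add_eq (r s B : ℕ) :
    ∑ i ∈ Finset.range r, (if i + s = B then 1 else 0 : ℚ) =
      if s ≤ B ∧ B < s + r then 1 else 0 := by
  by_cases h : s ≤ B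
  · have h1 : ∀ i, i + s = B ↔ i = B - s := fun i => by omega
    simp only [h1, Finset.sum_ite_eq', Finset.mem_range]
    congr 1
    simp only [eq_iff_iff]
    omega
  · rw [if_neg fun h' => h h'.1]
    exact Finset.sum_eq_zero fun i _ => if_neg (by omega)

/-- In column c such a cell lies in a row of length c + A and is unique; columns beyond the size of
the partition contribute nothing, so any bound C will do. -/
lemma sum_cells_ite (A B : ℕ) {C : ℕ} {lam : Ptn} (hC : lam.1 ≤ C) :
    ∑ x ∈ (young lam).cells,
        (if arm (young lam) x = A ∧ leg (young lam) x = B then 1 else 0 : ℚ) =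
      ∑ c ∈ Finset.Icc 1 C, if partsBetween c (c + A) lam ≤ B ∧
        B < partsBetween c (c + A + 1) lam then 1 else 0 := by
  rw [sum_arm_leg lam fun x y => if x = A ∧ y = B then (1 : ℚ) else 0]
  rw [Finset.sum_comm' (t' := Finset.Icc 1 C) (s' := fun c => Finset.Icc c lam.1)]
  · refine Finset.sum_congr rfl fun c _ => ?_
    have h1 : ∀ m ∈ Finset.Icc c lam.1, ∑ i ∈ Finset.range (mult m lam),
        (if m - c = A ∧ i + partsBetween c m lam = B then (1 : ℚ) else 0) =
        if m = c + A then (if partsBetween c (c + A) lam ≤ B ∧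
          B < partsBetween c (c + A + 1) lam then 1 else 0) else 0 := by
      intro m hm
      have hm := Finset.mem_Icc.1 hm
      by_cases h : m = c + A
      · subst h
        simp only [Nat.add_sub_cancel_left, true_and, if_true]
        rw [sum_range_ite_add_eq, partsBetween_succ hm.1]
      · rw [if_neg h]
        exact Finset.sum_eq_zero fun i _ => if_neg (by omega)
    rw [Finset.sum_congr rfl h1, Finset.sum_ite_eq']
    by_cases h : c + A ≤ lam.1
    · rw [if_pos (Finset.mem_Icc.2 ⟨Nat.le_add_right c A, h⟩)]
    · rw [if_neg fun h' => h (Finset.mem_Icc.1 h').2,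
        partsBetween_succ (Nat.le_add_right c A), mult_eq_zero (not_le.1 h), if_neg (by omega)]
  · intro m c
    simp only [Finset.mem_Icc]
    omega

/-- The series `∑_{r ≥ 1} X^(h r)`. -/
noncomputable def multiplesSeries (h : ℕ) : ℚ⟦X⟧ :=
  PowerSeries.mk fun n => if h ∣ n ∧ n ≠ 0 then 1 else 0

lemma one_sub_mul_multiplesSeries {h : ℕ} (hh : 0 < h) :
    (1 - PowerSeries.X ^ h) * multiplesSeries h = PowerSeries.X ^ h := by
  ext n
  rw [sub_mul, one_mul, map_sub, PowerSeries.coeff_X_pow_mul', PowerSeries.coeff_X_pow,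
    multiplesSeries, PowerSeries.coeff_mk]
  by_cases hn : h ≤ n
  · obtain ⟨k, rfl⟩ := Nat.exists_eq_add_of_le' hn
    rw [if_pos hn, PowerSeries.coeff_mk, Nat.add_sub_cancel]
    rcases Nat.eq_zero_or_pos k with rfl | hk
    · simp [hh.ne']
    · simp [hk.ne', hh.ne']
  · have h1 : ¬ (h ∣ n ∧ n ≠ 0) := fun h' => hn (Nat.le_of_dvd (Nat.pos_of_ne_zero h'.2) h'.1)
    have h2 : n ≠ h := by omega
    rw [if_neg h1, if_neg hn, if_neg h2, sub_zero]

/-- The number of cells of given arm and leg length in all partitions depends only on the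
hook length. -/
theorem partitionSeries_cells (A B : ℕ) :
    partitionSeries (fun lam => ∑ x ∈ (young lam).cells,
        if arm (young lam) x = A ∧ leg (young lam) x = B then 1 else 0) =
      partitionSeries 1 * multiplesSeries (A + B + 1) := by
  refine mul_left_cancel₀ (one_sub_X_pow_ne_zero (Nat.succ_pos (A + B))) ?_
  rw [mul_left_comm, one_sub_mul_multiplesSeries (Nat.succ_pos (A + B)), ← sub_eq_zero]
  ext n
  -- The coefficient of q^n sees only the columns up to n, so a congruence modulo q^(n+1) suffices.
  obtain ⟨u, hu⟩ := X_pow_dvd_sum_cellSeries n A B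
  set W := partitionSeries (fun lam => ∑ x ∈ (young lam).cells,
    if arm (young lam) x = A ∧ leg (young lam) x = B then 1 else 0) with hW
  have h1 : (PowerSeries.X : ℚ⟦X⟧) ^ (n + 1) ∣ W - ∑ c ∈ Finset.Icc 1 n, cellSeries c A B := by
    rw [PowerSeries.X_pow_dvd_iff]
    intro k hk
    simp only [hW, cellSeries, ← map_sum, ← map_sub]
    rw [coeff_partitionSeries]
    refine Finset.sum_eq_zero fun p _ => ?_
    rw [Pi.sub_apply, Finset.sum_apply,
      sum_cells_ite A B (C := n) (by simpa using Nat.lt_succ_iff.1 hk),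
      sub_self]
  obtain ⟨v, hv⟩ := h1
  have h2 : (PowerSeries.X : ℚ⟦X⟧) ^ (n + 1) ∣ (1 - PowerSeries.X ^ (A + B + 1)) * W -
      partitionSeries 1 * PowerSeries.X ^ (A + B + 1) :=
    ⟨u + (1 - PowerSeries.X ^ (A + B + 1)) * v, by
      linear_combination hu + (1 - PowerSeries.X ^ (A + B + 1)) * hv⟩
  rw [map_zero]
  exact PowerSeries.X_pow_dvd_iff.1 h2 n (Nat.lt_succ_self n)

/-- The series `∑_n (∑_{d ∣ n} f(d)) X^n`, without constant term. -/
noncomputable def divisorSumSeries (f : ℕ → ℚ) : ℚ⟦X⟧ :=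
  PowerSeries.mk fun n => ∑ d ∈ n.divisors, f d

lemma coeff_mul_divisorSumSeries (P : ℚ⟦X⟧) (f : ℕ → ℚ) {n K : ℕ} (hK : n ≤ K) :
    PowerSeries.coeff n (P * divisorSumSeries f) =
      ∑ h ∈ Finset.range K, f (h + 1) * PowerSeries.coeff n (P * multiplesSeries (h + 1)) := by
  simp only [PowerSeries.coeff_mul, divisorSumSeries, multiplesSeries, PowerSeries.coeff_mk,
    Finset.mul_sum]
  rw [Finset.sum_comm]
  refine Finset.sum_congr rfl fun ij hij => ?_
  have hj : ij.2 ≤ K := by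
    have := Finset.HasAntidiagonal.mem_antidiagonal.1 hij
    omega
  have h1 := Finset.sum_Ico_add' (fun d => f d * (PowerSeries.coeff ij.1 P *
    if d ∣ ij.2 ∧ ij.2 ≠ 0 then 1 else 0)) 0 K 1
  rw [← Finset.range_eq_Ico] at h1
  rw [h1]
  have h2 : ij.2.divisors ⊆ Finset.Ico (0 + 1) (K + 1) := fun d hd => by
    have h3 := Nat.pos_of_mem_divisors hd
    have h4 := Nat.divisor_le hd
    rw [Finset.mem_Ico]
    omega
  rw [← Finset.sum_subset h2]
  · refine Finset.sum_congr rfl fun d hd => ?_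
    rw [if_pos (Nat.mem_divisors.1 hd), mul_one, mul_comm]
  · intro d _ hd
    rw [if_neg fun h => hd (Nat.mem_divisors.2 h), mul_zero, mul_zero]

/-- The generating series of a sum over all cells of a function of arm and leg length. -/
theorem partitionSeries_sum_arm_leg (f : ℕ → ℕ → ℚ) :
    partitionSeries (fun lam => ∑ x ∈ (young lam).cells,
        f (arm (young lam) x) (leg (young lam) x)) =
      partitionSeries 1 * divisorSumSeries fun h =>
        ∑ AB ∈ Finset.HasAntidiagonal.antidiagonal (h - 1), f AB.1 AB.2 := by
  ext n
  -- K bounds both n and every hook length in a partition of n, so the finite sum over h reaches all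
  -- cells.
  set K := max n ((Finset.univ : Finset (Nat.Partition n)).sup fun p =>
    (young ⟨n, p⟩).cells.sup fun x => arm (young ⟨n, p⟩) x + leg (young ⟨n, p⟩) x + 1) with hK
  rw [coeff_mul_divisorSumSeries _ _ (le_max_left _ _ : n ≤ K), coeff_partitionSeries]
  simp only [Nat.add_sub_cancel, Finset.sum_mul]
  have h1 : ∀ h, ∀ AB ∈ Finset.HasAntidiagonal.antidiagonal h, f AB.1 AB.2 *
      PowerSeries.coeff n (partitionSeries 1 * multiplesSeries (h + 1)) =
      ∑ p : Nat.Partition n, ∑ x ∈ (young ⟨n, p⟩).cells,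
        if arm (young ⟨n, p⟩) x = AB.1 ∧ leg (young ⟨n, p⟩) x = AB.2 then f AB.1 AB.2 else 0 := by
    intro h AB hAB
    rw [← Finset.HasAntidiagonal.mem_antidiagonal.1 hAB, ← partitionSeries_cells,
      coeff_partitionSeries]
    simp only [Finset.mul_sum, mul_ite, mul_one, mul_zero]
  rw [Finset.sum_congr rfl fun h _ => Finset.sum_congr rfl (h1 h),
    Finset.sum_congr rfl fun h _ => Finset.sum_comm, Finset.sum_comm]
  refine Finset.sum_congr rfl fun p _ => ?_
  rw [Finset.sum_congr rfl fun h _ => Finset.sum_comm, Finset.sum_comm]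
  refine Finset.sum_congr rfl fun x hx => ?_
  have h2 : arm (young ⟨n, p⟩) x + leg (young ⟨n, p⟩) x + 1 ≤ K :=
    (Finset.le_sup (f := fun x => arm (young ⟨n, p⟩) x + leg (young ⟨n, p⟩) x + 1) hx).trans
      ((Finset.le_sup (f := fun p : Nat.Partition n => (young ⟨n, p⟩).cells.sup fun x =>
        arm (young ⟨n, p⟩) x + leg (young ⟨n, p⟩) x + 1) (Finset.mem_univ p)).trans
        (le_max_right _ _))
  generalize arm (young ⟨n, p⟩) x = A at h2
  generalize leg (young ⟨n, p⟩) x = B at h2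
  rw [Finset.sum_eq_single_of_mem (A + B) (Finset.mem_range.2 h2),
    Finset.sum_eq_single_of_mem (A, B) (Finset.HasAntidiagonal.mem_antidiagonal.2 rfl)]
  · simp
  · rintro ⟨a, b⟩ _ hne
    refine if_neg fun h => hne ?_
    simp [h.1, h.2]
  · intro h _ hne
    refine Finset.sum_eq_zero fun AB hAB => if_neg fun h' => hne ?_
    rw [← Finset.HasAntidiagonal.mem_antidiagonal.1 hAB, h'.1, h'.2]

/-! ### Odd polynomials and Eisenstein series -/

section Eisenstein

open Polynomial

lemma algebraMap_mem_quasimodularForms (a : ℚ) : PowerSeries.C a ∈ quasimodularForms :=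
  Subalgebra.algebraMap_mem quasimodularForms a

lemma divisorSumSeries_pow_mem {k : ℕ} (hk : Odd k) :
    divisorSumSeries (fun d => (d : ℚ) ^ k) ∈ quasimodularForms := by
  have h1 : eisenstein (k + 1) ∈ quasimodularForms :=
    Algebra.subset_adjoin ⟨k + 1, by have := hk.pos; omega, hk.add_one, rfl⟩
  have h2 : divisorSumSeries (fun d => (d : ℚ) ^ k) = (k ! : ℚ) • (eisenstein (k + 1) -
      PowerSeries.C (-(_root_.bernoulli (k + 1)) / (2 * ((k + 1)! : ℚ)))) := by
    ext n
    rw [eisenstein, add_sub_cancel_left, divisorSumSeries, PowerSeries.coeff_mk,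
      PowerSeries.coeff_smul, PowerSeries.coeff_mk, Nat.add_sub_cancel,
      Nat.sum_divisorsAntidiagonal (fun d _ => (d : ℚ) ^ k), smul_eq_mul, ← mul_assoc,
      mul_one_div_cancel (by positivity), one_mul]
  rw [h2]
  exact Subalgebra.smul_mem _ (Subalgebra.sub_mem _ h1 (algebraMap_mem_quasimodularForms _)) _

lemma divisorSumSeries_odd_mem {Q : ℚ[X]} (hQ : ∀ x, Q.eval (-x) = -Q.eval x) :
    divisorSumSeries (fun d => Q.eval (d : ℚ)) ∈ quasimodularForms := by
  have h1 : Q.comp (-X) = -Q := Polynomial.funext fun x => by simp [hQ]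
  have h2 : ∀ k, ¬ Odd k → Q.coeff k = 0 := by
    intro k hk
    have h3 := congrArg (fun P => P.coeff k) h1
    rw [show (-X : ℚ[X]) = C (-1) * X by simp] at h3
    simp only [comp_C_mul_X_coeff, coeff_neg, (Nat.not_odd_iff_even.1 hk).neg_one_pow,
      mul_one] at h3
    linarith
  have h4 : divisorSumSeries (fun d => Q.eval (d : ℚ)) = ∑ k ∈ Finset.range (Q.natDegree + 1),
      Q.coeff k • divisorSumSeries (fun d => (d : ℚ) ^ k) := by
    ext n
    simp only [divisorSumSeries, map_sum, PowerSeries.coeff_smul, PowerSeries.coeff_mk,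
      eval_eq_sum_range, smul_eq_mul, Finset.mul_sum]
    exact Finset.sum_comm
  rw [h4]
  refine Subalgebra.sum_mem _ fun k _ => ?_
  by_cases hk : Odd k
  · exact Subalgebra.smul_mem _ (divisorSumSeries_pow_mem hk) _
  · rw [h2 k hk, zero_smul]
    exact Subalgebra.zero_mem _

/-- The polynomial with value `∑_{A + B = h - 1} (A + 1 / 2) ^ a (B + 1 / 2) ^ b` at `h ≥ 1`. -/
noncomputable def hookSum (a b : ℕ) : ℚ[X] :=
  ∑ i ∈ Finset.range (b + 1),
    C ((-1) ^ (b - i) * (b.choose i : ℚ)) * X ^ i * midpointSum (a + (b - i))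

/-- Each summand has parity i + (a + b - i + 1) = a + b + 1, which is odd. -/
lemma eval_hookSum_neg {a b : ℕ} (hab : Even (a + b)) (x : ℚ) :
    (hookSum a b).eval (-x) = -(hookSum a b).eval x := by
  simp only [hookSum, eval_finsetSum, eval_mul, eval_C, eval_pow, eval_X, eval_midpointSum_neg,
    ← Finset.sum_neg_distrib]
  refine Finset.sum_congr rfl fun i hi => ?_
  have hi := Finset.mem_range_succ_iff.1 hi
  have h : (-1 : ℚ) ^ i * (-1) ^ (a + (b - i) + 1) = -1 := by
    rw [← pow_add, show i + (a + (b - i) + 1) = a + b + 1 by omega, pow_succ, hab.neg_one_pow]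
    ring
  rw [neg_pow x]
  linear_combination (-1 : ℚ) ^ (b - i) * (b.choose i : ℚ) * x ^ i *
    (midpointSum (a + (b - i))).eval x * h

lemma eval_hookSum (a b : ℕ) {h : ℕ} (hh : 0 < h) :
    ∑ AB ∈ Finset.HasAntidiagonal.antidiagonal (h - 1),
        ((AB.1 : ℚ) + 1 / 2) ^ a * ((AB.2 : ℚ) + 1 / 2) ^ b =
      (hookSum a b).eval (h : ℚ) := by
  obtain ⟨n, rfl⟩ := Nat.exists_eq_add_of_le' hh
  rw [Nat.add_sub_cancel, Finset.Nat.sum_antidiagonal_eq_sum_range_succ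
    (fun A B => ((A : ℚ) + 1 / 2) ^ a * ((B : ℚ) + 1 / 2) ^ b)]
  have h1 : ∀ A ∈ Finset.range n.succ,
      ((A : ℚ) + 1 / 2) ^ a * (((n - A : ℕ) : ℚ) + 1 / 2) ^ b =
      ∑ i ∈ Finset.range (b + 1), (-1) ^ (b - i) * (b.choose i : ℚ) * ((n + 1 : ℕ) : ℚ) ^ i *
        ((A : ℚ) + 1 / 2) ^ (a + (b - i)) := by
    intro A hA
    have hA := Finset.mem_range_succ_iff.1 hA
    -- As A + B + 1 = h, the leg variable is h minus the arm variable; expanding binomially leaves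
    -- power sums in A + 1/2.
    rw [Nat.cast_sub hA, show (n : ℚ) - A + 1 / 2 = ((n + 1 : ℕ) : ℚ) + -((A : ℚ) + 1 / 2) by
      push_cast
      ring, add_pow ((n + 1 : ℕ) : ℚ) _ b, Finset.mul_sum]
    refine Finset.sum_congr rfl fun i _ => ?_
    rw [neg_pow ((A : ℚ) + 1 / 2), pow_add]
    ring
  rw [Finset.sum_congr rfl h1, Finset.sum_comm]
  simp only [hookSum, eval_finsetSum, eval_mul, eval_C, eval_pow, eval_X]
  refine Finset.sum_congr rfl fun i _ => ?_
  have h2 := sum_midpoint_pow (a + (b - i)) (n + 1) 0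
  simp only [add_zero, zero_add, Nat.cast_zero, eval_midpointSum_zero, sub_zero] at h2
  rw [← Finset.mul_sum, h2]

end Eisenstein

/-! ### Quasimodularity of the q-bracket -/

lemma partitionSeries_one_mul_inv :
    partitionSeries 1 * (PowerSeries.mk fun n => (Fintype.card (Nat.Partition n) : ℚ))⁻¹ = 1 := by
  have h : partitionSeries 1 = PowerSeries.mk fun n => (Fintype.card (Nat.Partition n) : ℚ) := by
    ext n
    rw [coeff_partitionSeries, PowerSeries.coeff_mk]
    simp
  rw [h]
  refine PowerSeries.mul_inv_cancel _ ?_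
  rw [← PowerSeries.coeff_zero_eq_constantCoeff_apply, PowerSeries.coeff_mk]
  simp

lemma qBracket_eq (f : Ptn → ℚ) : qBracket f = partitionSeries f *
    (PowerSeries.mk fun n => (Fintype.card (Nat.Partition n) : ℚ))⁻¹ := rfl

theorem qBracket_doubleDiffSum_mem {a b : ℕ} (hab : Even (a + b)) :
    qBracket (doubleDiffSum (midpointSum a) (midpointSum b)) ∈ quasimodularForms := by
  have h : divisorSumSeries (fun h => ∑ AB ∈ Finset.HasAntidiagonal.antidiagonal (h - 1),
      ((AB.1 : ℚ) + 1 / 2) ^ a * ((AB.2 : ℚ) + 1 / 2) ^ b) =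
      divisorSumSeries fun d => (hookSum a b).eval (d : ℚ) := by
    ext n
    simp only [divisorSumSeries, PowerSeries.coeff_mk]
    exact Finset.sum_congr rfl fun d hd => eval_hookSum a b (Nat.pos_of_mem_divisors hd)
  rw [← funext (sum_arm_pow_mul_leg_pow a b), qBracket_eq,
    partitionSeries_sum_arm_leg fun A B => ((A : ℚ) + 1 / 2) ^ a * ((B : ℚ) + 1 / 2) ^ b,
    mul_right_comm, partitionSeries_one_mul_inv, one_mul, h]
  exact divisorSumSeries_odd_mem (eval_hookSum_neg hab)

lemma coeff_aeval_neg_X (g : MvPolynomial (Fin 2) ℚ) (d : Fin 2 →₀ ℕ) :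
    (MvPolynomial.aeval (fun i => -(MvPolynomial.X i : MvPolynomial (Fin 2) ℚ)) g).coeff d =
      (-1) ^ (d 0 + d 1) * g.coeff d := by
  induction g using MvPolynomial.induction_on' with
  | monomial s q =>
    have h : MvPolynomial.aeval (fun i => -(MvPolynomial.X i : MvPolynomial (Fin 2) ℚ))
        (MvPolynomial.monomial s q) =
        MvPolynomial.C ((-1) ^ (s 0 + s 1)) * MvPolynomial.monomial s q := by
      rw [MvPolynomial.aeval_monomial, MvPolynomial.monomial_eq, MvPolynomial.algebraMap_eq,
        Finsupp.prod_fintype _ _ (fun _ => pow_zero _),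
        Finsupp.prod_fintype _ _ (fun _ => pow_zero _), Fin.prod_univ_two, Fin.prod_univ_two,
        neg_pow (MvPolynomial.X (0 : Fin 2) : MvPolynomial (Fin 2) ℚ),
        neg_pow (MvPolynomial.X (1 : Fin 2) : MvPolynomial (Fin 2) ℚ)]
      simp only [pow_add, map_mul, map_pow, map_neg, map_one]
      ring
    rw [h, MvPolynomial.coeff_C_mul, MvPolynomial.coeff_monomial]
    split_ifs with hsd
    · rw [hsd]
    · simp
  | add p q hp hq => rw [map_add, MvPolynomial.coeff_add, MvPolynomial.coeff_add, hp, hq, mul_add]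

theorem qBracket_armLegMoment_mem {g : MvPolynomial (Fin 2) ℚ}
    (hg : MvPolynomial.aeval (fun i => -(MvPolynomial.X i : MvPolynomial (Fin 2) ℚ)) g = g) :
    qBracket (armLegMoment g) ∈ quasimodularForms := by
  rw [armLegMoment_eq_sum, qBracket_eq, map_sum, Finset.sum_mul]
  refine Subalgebra.sum_mem _ fun d hd => ?_
  rw [map_smul, smul_mul_assoc, ← qBracket_eq]
  refine Subalgebra.smul_mem _ (qBracket_doubleDiffSum_mem ?_) _
  -- Invariance under negation kills every monomial of odd total degree.
  by_contra hodd
  have h := coeff_aeval_neg_X g d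
  rw [hg, (Nat.not_even_iff_odd.1 hodd).neg_one_pow] at h
  exact MvPolynomial.mem_support_iff.1 hd (by linarith)

end ArmLeg

theorem mainTheorem4 :
    (∀ g : MvPolynomial (Fin 2) ℚ,
      ArmLeg.armLegMoment g ∈ ArmLeg.polynomialFunctions ∧
      ArmLeg.HasWeightLE (ArmLeg.armLegMoment g) (g.totalDegree + 2)) ∧
    (∀ g : MvPolynomial (Fin 2) ℚ,
      MvPolynomial.aeval (fun i => -(MvPolynomial.X i : MvPolynomial (Fin 2) ℚ)) g = g →
      ArmLeg.armLegMoment g ∈ ArmLeg.quasimodularFunctions) ∧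
    (∀ (F : ℕ → Polynomial ℚ), ArmLeg.IsWellNormalized F → ∀ a b : ℕ,
      ArmLeg.HasWeightLE
        (ArmLeg.armLegMoment
            (MvPolynomial.C (1 / ((a ! : ℚ) * (b ! : ℚ))) *
              MvPolynomial.X 0 ^ a * MvPolynomial.X 1 ^ b) -
          ∑ i ∈ Finset.range (a + 1),
            ((-1 : ℚ) ^ (a - i) / ((i ! : ℚ) * ((a + 1 - i)! : ℚ))) •
              ArmLeg.expP F (fun _ : Fin (b + 1) => 1) (ArmLeg.endVector b i (a + 1 - i)))
        (a + b + 1)) :=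
  ⟨fun g => ⟨(ArmLeg.hasWeightLE_armLegMoment g).mem, ArmLeg.hasWeightLE_armLegMoment g⟩,
    fun g hg => ⟨(ArmLeg.hasWeightLE_armLegMoment g).mem, ArmLeg.qBracket_armLegMoment_mem hg⟩,
    fun _ hF a b => ArmLeg.hasWeightLE_armLegMoment_sub_expP hF a b⟩
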